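/- Let $(b_k,e_k)$, $k\ge 0$, be independent, identically distributed random vectors in $\mathbb R^2$ with $Eb_0=0$, $Eb_0^2=\omega^2$ where $\omega>0$, $Ee_0=0$, $Ee_0^2=\sigma^2>0$, $\operatorname{cov}(b_0,e_0)=0$, $Eb_0^4<\infty$ and $Ee_0^4<\infty$. Let $\varphi\in\mathbb R$ satisfy $E\log|\varphi+b_0|\ge 0$ (with $\log 0=-\infty$). Let $X_0$ be a real constant and $X_k=(\varphi+b_k)X_{k-1}+e_k$ for $k\ge 1$. For $s\in\mathbb R$ and $x,y>0$ put $$L_n(s,x,y)=-\frac12\sum_{k=1}^n\left(\log(xX_{k-1}^2+y)+\frac{(X_k-sX_{k-1})^2}{xX_{k-1}^2+y}\right),$$ and let $\Gamma=[s_*,s^*]\times[x_*,x^*]$ with $s_*<s^*$ and $0<x_*<x^*$, where $s_*<\varphi<s^*$ and $x_*\le\omega^2\le x^*$. For $y>0$ let $\widehat\eta_n(y)=(\widehat\eta_{n,1}(y),\widehat\eta_{n,2}(y))$ be a random vector that almost surely maximizes $(s,x)\mapsto L_n(s,x,y)$ over $\Gamma$. Then, for every $y>0$, as $n\to\infty$,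 $$\frac{\sqrt n\,(\widehat\eta_{n,1}(y)-\varphi)}{\omega}\xrightarrow{\ \mathcal D\ }N(0,1)\qquad\text{and}\qquad \frac{\sqrt n\,(\widehat\eta_{n,1}(y)-\varphi)}{\sqrt{\widehat\eta_{n,2}(y)}}\xrightarrow{\ \mathcal D\ }N(0,1).$$ -/

import Mathlib

open MeasureTheory ProbabilityTheory Filter

noncomputable section

/-- The random coefficient autoregressive process started from the constant `x₀`:
`X 0 = x₀` and `X k = (φ + b k) * X (k - 1) + e k` for `k ≥ 1`. -/
def rcaProcess {Ω : Type*} (φ x₀ : ℝ) (b e : ℕ → Ω → ℝ) : ℕ → Ω → ℝ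
  | 0 => fun _ => x₀
  | k + 1 => fun ω => (φ + b (k + 1) ω) * rcaProcess φ x₀ b e k ω + e (k + 1) ω

/-- The Gaussian quasi-log-likelihood `L_n(s, x, y)` (constants omitted) of the observations
`X 0, …, X n`. -/
def quasiLogLik (X : ℕ → ℝ) (n : ℕ) (s x y : ℝ) : ℝ :=
  ∑ k ∈ Finset.Icc 1 n,
    -(1 / 2 : ℝ) * (Real.log (x * X (k - 1) ^ 2 + y)
      + (X k - s * X (k - 1)) ^ 2 / (x * X (k - 1) ^ 2 + y))

/-- The point `z` maximizes `(s, x) ↦ L_n(s, x, y)` over the set `Γ`. -/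
def IsQMLE (X : ℕ → ℝ) (n : ℕ) (y : ℝ) (Γ : Set (ℝ × ℝ)) (z : ℝ × ℝ) : Prop :=
  z ∈ Γ ∧ IsMaxOn (fun u : ℝ × ℝ => quasiLogLik X n u.1 u.2 y) Γ z

/-- `E log |Z| ≥ 0`, where `log 0 = -∞`. Since `Real.log 0 = 0`, the requirement `Z ≠ 0` a.s.
(without which the mean is `-∞`) is stated separately. For `Z` with `E log⁺ |Z| < ∞` the
conjunction is equivalent to `E log |Z| ∈ [0, ∞)`. -/
def LogMeanNonneg {Ω : Type*} [MeasurableSpace Ω] (Z : Ω → ℝ) (P : Measure Ω) : Prop :=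
  (∀ᵐ ω ∂P, Z ω ≠ 0) ∧ Integrable (fun ω => Real.log |Z ω|) P ∧
    0 ≤ ∫ ω, Real.log |Z ω| ∂P

end

/-! Since `E log|φ + b₀| ≥ 0`, the process escapes to infinity in the Cesàro sense: the averages of
`E (1 + |X k|)⁻¹` tend to `0`. Once `|X k|` is large, `x X k ^ 2 / (x X k ^ 2 + y)` is close to `1`
and the additive noise is negligible, so the likelihood is nearly that of the observations `φ + b
k`.

Escape (`IsIIDNoise.tendsto_average_inv_one_add_abs`). Otherwise a vague limit of the averaged laws
is nonzero and, normalized, is a stationary law `μ` (`exists_stationary_of_not_tendsto_cesaroMean`).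
With `ψ` its characteristic function and `(A, B) = (φ + b₀, e₀)`, stationarity says that `exp(itB)
ψ(At)` has mean `ψ(t)`, hence `|ψ(t)|² ≤ E|ψ(At)|²`. On the scale `t exp s` the function `1 - |ψ|²`
therefore decreases in mean under the shift `log|A|`, whose mean is nonnegative; the Liouville
property `mean_shift_eq_of_mean_shift_le` forces equality. The variance of `exp(itB) ψ(At)` then
vanishes, so almost every map `x ↦ A x + B` preserves `μ`, and these maps have a common fixed point
(`exists_fixedPoint_of_stationary`). This contradicts the nondegeneracy and uncorrelatedness of the
noise.

Slope. In `s` the likelihood is quadratic, so the slope estimator is a weighted least squares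
estimator with weights depending on the estimated scale. Escape reduces `√n (ŝ - φ)` to `n^(-1/2) ∑
b k` up to `o(1)` in probability (`tendstoInMeasure_slope_sub`). The estimated scale depends on the
whole sample, which spoils orthogonality of the summands; a geometric expansion
(`hasSum_div_quadratic`) separates it from the process, giving bounds uniform in the scale
(`tendstoInMeasure_weighted`).

Scale. Comparing the likelihood at the maximizer with its value at the same slope and scale `w ^ 2`
shows that `log(x̂ / w²) + w² / x̂ - 1` is at most `o(1)`. This quantity dominates `(w / √x̂ - 1)²`,
so `x̂` is consistent (`tendstoInMeasure_scale`). The central limit theorem and Slutsky's theorem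
finish the proof. -/

open scoped Topology CompactlySupported ENNReal

/-! ### A Liouville property of bounded functions that decrease in mean along a drift -/

section Liouville

/-- Shifting the window of integration. -/
lemma integral_shift_sub_integral {f : ℝ → ℝ} (hf : Continuous f) (a b r : ℝ) :
    (∫ s in a..b, (f (s + r) - f s)) = (∫ s in b..(b + r), f s) - ∫ s in a..(a + r), f s := by
  have h (u v : ℝ) : IntervalIntegrable f volume u v := hf.intervalIntegrable u v
  rw [intervalIntegral.integral_sub
    (Continuous.intervalIntegrable (by fun_prop) _ _) (h _ _),
    intervalIntegral.integral_comp_add_right]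
  have h1 := intervalIntegral.integral_add_adjacent_intervals (h a (a + r)) (h (a + r) (b + r))
  have h2 := intervalIntegral.integral_add_adjacent_intervals (h a b) (h b (b + r))
  linarith

/-- The primitive of `U` that vanishes at `0`. -/
noncomputable def primitiveZero (U : ℝ → ℝ) (x : ℝ) : ℝ := ∫ s in (0 : ℝ)..x, U s

variable {U : ℝ → ℝ}

lemma primitiveZero_sub (hU : Continuous U) (a b : ℝ) :
    primitiveZero U b - primitiveZero U a = ∫ s in a..b, U s :=
  intervalIntegral.integral_interval_sub_left (hU.intervalIntegrable _ _)
    (hU.intervalIntegrable _ _)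

lemma continuous_primitiveZero (hU : Continuous U) : Continuous (primitiveZero U) :=
  intervalIntegral.continuous_primitive (fun _ _ => hU.intervalIntegrable _ _) 0

lemma abs_primitiveZero_sub_le (hU : Continuous U) (hU0 : ∀ s, 0 ≤ U s) (hU1 : ∀ s, U s ≤ 1)
    (a b : ℝ) : |primitiveZero U b - primitiveZero U a| ≤ |b - a| := by
  rw [primitiveZero_sub hU]
  simpa using intervalIntegral.norm_integral_le_of_norm_le_const (a := a) (b := b) (C := 1)
    (f := U) (fun x _ => by rw [Real.norm_eq_abs, abs_of_nonneg (hU0 x)]; exact hU1 x)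

/-- The primitive is 1-Lipschitz because `0 ≤ U ≤ 1`, so over the window it stays within `|r|` of
its value at `c`. -/
lemma abs_integral_primitiveZero_sub_le (hU : Continuous U) (hU0 : ∀ s, 0 ≤ U s)
    (hU1 : ∀ s, U s ≤ 1) (c r : ℝ) :
    |(∫ s in c..(c + r), primitiveZero U s) - r * primitiveZero U c| ≤ r ^ 2 := by
  have hG := continuous_primitiveZero hU
  have h : (∫ s in c..(c + r), primitiveZero U s) - r * primitiveZero U c
      = ∫ s in c..(c + r), (primitiveZero U s - primitiveZero U c) := by
    rw [intervalIntegral.integral_sub (hG.intervalIntegrable _ _) (by simp)]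
    simp
  rw [h]
  have := intervalIntegral.norm_integral_le_of_norm_le_const (a := c) (b := c + r) (C := |r|)
    (f := fun s => primitiveZero U s - primitiveZero U c) (fun x hx => by
      refine (abs_primitiveZero_sub_le hU hU0 hU1 c x).trans ?_
      have := Set.abs_sub_left_of_mem_uIcc (Set.uIoc_subset_uIcc hx)
      simpa using this)
  simpa [← sq] using this

variable {Ω : Type*} [MeasurableSpace Ω] {P : Measure Ω} {ξ : Ω → ℝ}

lemma integrable_primitiveZero_shift (hU : Continuous U) (hU0 : ∀ s, 0 ≤ U s)
    (hU1 : ∀ s, U s ≤ 1) (hξm : Measurable ξ) (hξ : Integrable ξ P) (b : ℝ) :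
    Integrable (fun ω => primitiveZero U (b + ξ ω) - primitiveZero U b) P := by
  have hG := (continuous_primitiveZero hU).measurable
  refine hξ.norm.mono' (Measurable.aestronglyMeasurable (by fun_prop)) (.of_forall fun ω => ?_)
  simpa using abs_primitiveZero_sub_le hU hU0 hU1 b (b + ξ ω)

/-- The mean of `∫ s in b..(b + ξ), U s` vanishes as `b → -∞`. -/
lemma tendsto_mean_primitiveZero_shift (hU : Continuous U) (hU0 : ∀ s, 0 ≤ U s)
    (hU1 : ∀ s, U s ≤ 1) (hUbot : Tendsto U atBot (𝓝 0)) (hξm : Measurable ξ)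
    (hξ : Integrable ξ P) :
    Tendsto (fun b => ∫ ω, (primitiveZero U (b + ξ ω) - primitiveZero U b) ∂P) atBot (𝓝 0) := by
  have hG := (continuous_primitiveZero hU).measurable
  rw [← integral_zero Ω ℝ (μ := P)]
  refine tendsto_integral_filter_of_dominated_convergence (fun ω => |ξ ω|)
    (.of_forall fun b => Measurable.aestronglyMeasurable (by fun_prop))
    (.of_forall fun b => .of_forall fun ω => ?_) hξ.norm (.of_forall fun ω => ?_)
  · simpa using abs_primitiveZero_sub_le hU hU0 hU1 b (b + ξ ω)
  · have h1 (b : ℝ) : primitiveZero U (b + ξ ω) - primitiveZero U b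
        = ∫ s in (0 : ℝ)..(ξ ω), U (s + b) := by
      rw [primitiveZero_sub hU, intervalIntegral.integral_comp_add_right]
      simp [add_comm]
    simp_rw [h1]
    have h2 := intervalIntegral.tendsto_integral_filter_of_dominated_convergence
      (μ := volume) (a := 0) (b := ξ ω) (l := atBot) (F := fun b s => U (s + b)) (f := fun _ => 0)
      (fun _ => (1 : ℝ))
      (.of_forall fun b => Continuous.aestronglyMeasurable (by fun_prop))
      (.of_forall fun b => .of_forall fun s _ => by
        rw [Real.norm_eq_abs, abs_of_nonneg (hU0 _)]; exact hU1 _)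
      (by simp)
      (.of_forall fun s _ => hUbot.comp (tendsto_atBot_add_const_left _ s tendsto_id))
    simpa using h2

variable [IsProbabilityMeasure P]

lemma integrable_comp_add (hU : Continuous U) (hU0 : ∀ s, 0 ≤ U s)
    (hU1 : ∀ s, U s ≤ 1) (hξm : Measurable ξ) (s : ℝ) : Integrable (fun ω => U (s + ξ ω)) P :=
  (integrable_const (1 : ℝ)).mono' (Measurable.aestronglyMeasurable (by
    have := hU.measurable; fun_prop)) (.of_forall fun ω => by
    rw [Real.norm_eq_abs, abs_of_nonneg (hU0 _)]; exact hU1 _)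

/-- By Fubini the mean defect of `U` telescopes: shifting the window leaves only the two end pieces
of length `ξ`. -/
lemma integral_sub_mean_shift (hU : Continuous U) (hU0 : ∀ s, 0 ≤ U s)
    (hU1 : ∀ s, U s ≤ 1) (hξm : Measurable ξ) (hξ : Integrable ξ P) (a b : ℝ) :
    (∫ s in a..b, (U s - ∫ ω, U (s + ξ ω) ∂P))
      = (∫ ω, (primitiveZero U (a + ξ ω) - primitiveZero U a) ∂P)
        - ∫ ω, (primitiveZero U (b + ξ ω) - primitiveZero U b) ∂P := by
  have hUm := hU.measurable
  have h1 (s : ℝ) : U s - ∫ ω, U (s + ξ ω) ∂P = ∫ ω, (U s - U (s + ξ ω)) ∂P := by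
    rw [integral_sub (integrable_const _) (integrable_comp_add hU hU0 hU1 hξm s)]
    simp
  simp_rw [h1]
  rw [intervalIntegral_integral_swap]
  · rw [← integral_sub (integrable_primitiveZero_shift hU hU0 hU1 hξm hξ a)
      (integrable_primitiveZero_shift hU hU0 hU1 hξm hξ b)]
    congr 1 with ω
    have := integral_shift_sub_integral hU a b (ξ ω)
    rw [primitiveZero_sub hU, primitiveZero_sub hU]
    rw [← neg_inj, ← intervalIntegral.integral_neg, neg_sub, ← this]
    simp
  · have : IsFiniteMeasure (volume.restrict (Set.uIoc a b)) := ⟨by simp⟩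
    refine (integrable_const (1 : ℝ)).mono' (Measurable.aestronglyMeasurable ?_)
      (.of_forall fun p => ?_)
    · simp only [Function.uncurry_def]
      fun_prop
    · simp only [Function.uncurry_def]
      rw [Real.norm_eq_abs, abs_le]
      constructor <;> linarith [hU0 p.1, hU1 p.1, hU0 (p.1 + ξ p.2), hU1 (p.1 + ξ p.2)]

/-- The averages of the mean of `∫ s in b..(b + ξ), U s` over long windows of `b` are
asymptotically nonnegative when `ξ` has a nonnegative mean. -/
lemma exists_average_primitiveZero_shift_gt (hU : Continuous U) (hU0 : ∀ s, 0 ≤ U s)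
    (hU1 : ∀ s, U s ≤ 1) (hξm : Measurable ξ) (hξ : Integrable ξ P) (hmean : 0 ≤ ∫ ω, ξ ω ∂P)
    (c : ℝ) {δ : ℝ} (hδ : 0 < δ) :
    ∃ T : ℝ, 0 < T ∧ -(δ * T) < ∫ b in c..(c + T),
      (∫ ω, (primitiveZero U (b + ξ ω) - primitiveZero U b) ∂P) := by
  have hGc := continuous_primitiveZero hU
  have hG := hGc.measurable
  -- The error of the first-order approximation `ξ (G(c + T) - G(c))` to the window integral, over
  -- `T = n + 1`. Pointwise it is at most `2 ξ² / T`; as `ξ` need not be square integrable, the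
  -- limit in mean uses the other bound `2 |ξ|` as dominating function.
  let R (n : ℕ) (ω : Ω) : ℝ := ((n : ℝ) + 1)⁻¹ *
    ((∫ b in c..(c + (n + 1)), (primitiveZero U (b + ξ ω) - primitiveZero U b))
      - ξ ω * (primitiveZero U (c + (n + 1)) - primitiveZero U c))
  have hpos (n : ℕ) : (0 : ℝ) < n + 1 := by positivity
  have hmeas (n : ℕ) : Measurable fun ω =>
      ∫ b in c..(c + ((n : ℝ) + 1)), (primitiveZero U (b + ξ ω) - primitiveZero U b) := by
    have : Continuous fun r : ℝ =>
        ∫ b in c..(c + ((n : ℝ) + 1)), (primitiveZero U (b + r) - primitiveZero U b) :=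
      intervalIntegral.continuous_parametric_intervalIntegral_of_continuous' (by
        simp only [Function.uncurry_def]; fun_prop) _ _
    exact this.measurable.comp hξm
  have hI (n : ℕ) (ω : Ω) :
      |∫ b in c..(c + ((n : ℝ) + 1)), (primitiveZero U (b + ξ ω) - primitiveZero U b)|
        ≤ (n + 1) * |ξ ω| := by
    have := intervalIntegral.norm_integral_le_of_norm_le_const (a := c) (b := c + ((n : ℝ) + 1))
      (C := |ξ ω|) (f := fun b => primitiveZero U (b + ξ ω) - primitiveZero U b) (fun b _ => by
        simpa using abs_primitiveZero_sub_le hU hU0 hU1 b (b + ξ ω))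
    simpa [abs_of_pos (hpos n), mul_comm] using this
  have hGd (n : ℕ) : |primitiveZero U (c + (n + 1)) - primitiveZero U c| ≤ n + 1 := by
    simpa [abs_of_pos (hpos n)] using abs_primitiveZero_sub_le hU hU0 hU1 c (c + (n + 1))
  have hR : Tendsto (fun n => ∫ ω, R n ω ∂P) atTop (𝓝 (∫ _, (0 : ℝ) ∂P)) := by
    refine tendsto_integral_of_dominated_convergence (fun ω => 2 * |ξ ω|) (fun n => ?_)
      (hξ.norm.const_mul 2) (fun n => .of_forall fun ω => ?_) (.of_forall fun ω => ?_)
    · have := hmeas n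
      exact Measurable.aestronglyMeasurable (by fun_prop)
    · rw [Real.norm_eq_abs, abs_mul, abs_of_pos (inv_pos.2 (hpos n)), inv_mul_le_iff₀ (hpos n)]
      refine (abs_sub _ _).trans ?_
      rw [abs_mul]
      nlinarith [hI n ω, hGd n, abs_nonneg (ξ ω)]
    · have hb (n : ℕ) : |R n ω| ≤ ((n : ℝ) + 1)⁻¹ * (2 * ξ ω ^ 2) := by
        rw [abs_mul, abs_of_pos (inv_pos.2 (hpos n))]
        refine mul_le_mul_of_nonneg_left ?_ (inv_pos.2 (hpos n)).le
        rw [integral_shift_sub_integral hGc]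
        have h1 := abs_le.1 (abs_integral_primitiveZero_sub_le hU hU0 hU1 (c + ((n : ℝ) + 1)) (ξ ω))
        have h2 := abs_le.1 (abs_integral_primitiveZero_sub_le hU hU0 hU1 c (ξ ω))
        rw [abs_le]
        constructor <;> linarith
      refine squeeze_zero_norm hb ?_
      simpa [one_div] using (tendsto_one_div_add_atTop_nhds_zero_nat (𝕜 := ℝ)).mul_const
        (2 * ξ ω ^ 2)
  rw [integral_zero] at hR
  obtain ⟨n, hn⟩ := (hR.eventually_const_lt (show -δ < 0 by linarith)).exists
  refine ⟨n + 1, hpos n, ?_⟩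
  have hint : Integrable (fun ω => ∫ b in c..(c + ((n : ℝ) + 1)),
      (primitiveZero U (b + ξ ω) - primitiveZero U b)) P :=
    (hξ.norm.const_mul (n + 1 : ℝ)).mono' (hmeas n).aestronglyMeasurable (.of_forall (hI n))
  rw [intervalIntegral_integral_swap]
  · simp only [R] at hn
    rw [integral_const_mul, integral_sub hint (hξ.mul_const _), integral_mul_const,
      lt_inv_mul_iff₀ (hpos n)] at hn
    -- The only use of the sign of the drift: the main term is a product of two nonnegative factors.
    have h0 : 0 ≤ primitiveZero U (c + (n + 1)) - primitiveZero U c := by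
      rw [primitiveZero_sub hU]
      exact intervalIntegral.integral_nonneg (by linarith [hpos n]) fun s _ => hU0 s
    have := mul_nonneg hmean h0
    linarith
  · have : IsFiniteMeasure (volume.restrict (Set.uIoc c (c + ((n : ℝ) + 1)))) := ⟨by simp⟩
    refine (hξ.norm.comp_snd _).mono' (Measurable.aestronglyMeasurable ?_)
      (.of_forall fun p => ?_)
    · simp only [Function.uncurry_def]
      fun_prop
    · simpa [Function.uncurry_def] using abs_primitiveZero_sub_le hU hU0 hU1 p.1 (p.1 + ξ p.2)

/-- A continuous function with values in `[0, 1]` that vanishes at `-∞` and decreases in mean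
under a random shift with nonnegative mean is preserved in mean by the shift. -/
theorem mean_shift_eq_of_mean_shift_le (hU : Continuous U) (hU0 : ∀ s, 0 ≤ U s)
    (hU1 : ∀ s, U s ≤ 1) (hUbot : Tendsto U atBot (𝓝 0)) (hξm : Measurable ξ)
    (hξ : Integrable ξ P) (hmean : 0 ≤ ∫ ω, ξ ω ∂P)
    (hle : ∀ s, ∫ ω, U (s + ξ ω) ∂P ≤ U s) (s : ℝ) : ∫ ω, U (s + ξ ω) ∂P = U s := by
  set D : ℝ → ℝ := fun b => ∫ ω, (primitiveZero U (b + ξ ω) - primitiveZero U b) ∂P with hD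
  have hshift := integral_sub_mean_shift (P := P) hU hU0 hU1 hξm hξ
  have hUm := hU.measurable
  have hanti : Antitone D := fun a b hab => by
    have h1 := hshift a b
    have h2 : 0 ≤ ∫ s in a..b, (U s - ∫ ω, U (s + ξ ω) ∂P) :=
      intervalIntegral.integral_nonneg hab fun s _ => sub_nonneg.2 (hle s)
    simp only [hD]
    linarith
  have hD0 (b : ℝ) : D b ≤ 0 :=
    ge_of_tendsto (tendsto_mean_primitiveZero_shift (P := P) hU hU0 hU1 hUbot hξm hξ)
      ((eventually_le_atBot b).mono fun a ha => hanti ha)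
  -- If `D b < 0`, monotonicity keeps `D` below `D b` on the whole window to the right of `b`,
  -- against the lower bound for the window averages with `δ = -D b`.
  have hDzero (b : ℝ) : D b = 0 := by
    by_contra hne
    have hneg : D b < 0 := lt_of_le_of_ne (hD0 b) hne
    obtain ⟨T, hT, hlt⟩ := exists_average_primitiveZero_shift_gt (P := P) hU hU0 hU1 hξm hξ hmean b
      (δ := -D b) (by linarith)
    have h1 : ∫ x in b..(b + T), D x ≤ ∫ _ in b..(b + T), D b :=
      intervalIntegral.integral_mono_on (by linarith) (hanti.intervalIntegrable) (by simp)
        fun x hx => hanti hx.1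
    simp only [intervalIntegral.integral_const, smul_eq_mul] at h1
    simp only [hD] at h1 hlt
    linarith
  have hcont : Continuous fun s => U s - ∫ ω, U (s + ξ ω) ∂P := by
    refine hU.sub (continuous_of_dominated (bound := fun _ => 1)
      (fun s => Measurable.aestronglyMeasurable (by fun_prop))
      (fun s => .of_forall fun ω => ?_) (integrable_const _) (.of_forall fun ω => by fun_prop))
    rw [Real.norm_eq_abs, abs_of_nonneg (hU0 _)]; exact hU1 _
  by_contra hne
  have hpos : 0 < U s - ∫ ω, U (s + ξ ω) ∂P :=
    sub_pos.2 (lt_of_le_of_ne (hle s) hne)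
  have h1 : 0 < ∫ r in s..(s + 1), (U r - ∫ ω, U (r + ξ ω) ∂P) :=
    intervalIntegral.integral_pos (by linarith) hcont.continuousOn
      (fun x _ => sub_nonneg.2 (hle x)) ⟨s, by simp, hpos⟩
  rw [hshift] at h1
  have := hDzero s
  have := hDzero (s + 1)
  simp only [hD] at *
  linarith

end Liouville

/-! ### Probability measures preserved by affine maps of the line -/

section AffineInvariance

variable {μ : Measure ℝ}

lemma charFun_map_affine (a b t : ℝ) :
    charFun (μ.map (fun x => a * x + b)) t = Complex.exp (t * b * Complex.I) * charFun μ (a * t) := by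
  rw [charFun_apply_real, charFun_apply_real,
    integral_map (by fun_prop) (Continuous.aestronglyMeasurable (by fun_prop)),
    ← integral_const_mul]
  refine integral_congr_ae (.of_forall fun x => ?_)
  simp only [← Complex.exp_add]
  congr 1
  push_cast
  ring

variable [IsProbabilityMeasure μ]

/-- Iterating the contraction drives all the mass to its fixed point `b / (1 - a)` while the measure
stays the same. -/
lemma eq_dirac_of_map_contraction_eq {a b : ℝ} (ha : |a| < 1)
    (h : μ.map (fun x => a * x + b) = μ) : μ = Measure.dirac (b / (1 - a)) := by
  have ha1 : 1 - a ≠ 0 := by have := abs_lt.1 ha; linarith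
  set c := b / (1 - a) with hc
  have hb : b = c - a * c := by rw [hc]; field_simp
  refine ext_of_forall_integral_eq_of_IsFiniteMeasure fun f => ?_
  have hn (n : ℕ) : ∫ x, f (c + a ^ n * (x - c)) ∂μ = ∫ x, f x ∂μ := by
    induction n with
    | zero => simp
    | succ n ih =>
      rw [← ih]
      conv_rhs => rw [← h]
      rw [integral_map (by fun_prop) (Continuous.aestronglyMeasurable (by fun_prop))]
      refine integral_congr_ae (.of_forall fun x => ?_)
      simp only [hb]
      congr 1
      ring
  have hlim : Tendsto (fun n : ℕ => ∫ x, f (c + a ^ n * (x - c)) ∂μ) atTop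
      (𝓝 (∫ _, f c ∂μ)) := by
    refine tendsto_integral_of_dominated_convergence (fun _ => ‖f‖)
      (fun n => Continuous.aestronglyMeasurable (by fun_prop)) (integrable_const _)
      (fun n => .of_forall fun x => f.norm_coe_le_norm _) (.of_forall fun x => ?_)
    have h1 : Tendsto (fun n : ℕ => c + a ^ n * (x - c)) atTop (𝓝 (c + 0 * (x - c))) :=
      ((tendsto_pow_atTop_nhds_zero_of_abs_lt_one ha).mul_const _).const_add c
    rw [zero_mul, add_zero] at h1
    exact (f.continuous.tendsto c).comp h1
  simp_rw [hn] at hlim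
  rw [integral_dirac, tendsto_nhds_unique tendsto_const_nhds hlim]
  simp

/-- An expanding map is invertible and its inverse, a contraction, preserves the measure too. -/
lemma exists_eq_dirac_of_map_affine_eq {a b : ℝ} (ha0 : a ≠ 0) (ha : |a| ≠ 1)
    (h : μ.map (fun x => a * x + b) = μ) : ∃ c, μ = Measure.dirac c := by
  rcases lt_or_gt_of_ne ha with h1 | h1
  · exact ⟨_, eq_dirac_of_map_contraction_eq h1 h⟩
  · refine ⟨_, eq_dirac_of_map_contraction_eq (a := a⁻¹) (b := -(b / a)) ?_ ?_⟩
    · rw [abs_inv]; exact inv_lt_one_of_one_lt₀ h1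
    · conv_lhs => rw [← h]
      rw [Measure.map_map (by fun_prop) (by fun_prop)]
      convert! Measure.map_id (μ := μ) using 2
      ext x
      simp only [Function.comp_apply, id]
      field_simp
      ring

/-- Iterates of a nonzero translation carry all mass to infinity, which the test function `exp(-x²)`
detects. -/
lemma eq_zero_of_map_add_eq {b : ℝ} (h : μ.map (fun x => x + b) = μ) : b = 0 := by
  by_contra hb
  have hn (n : ℕ) : μ.map (fun x => x + n * b) = μ := by
    induction n with
    | zero => simp
    | succ n ih =>
      conv_rhs => rw [← h, ← ih]
      rw [Measure.map_map (by fun_prop) (by fun_prop)]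
      congr 1
      ext x
      simp
      ring
  have hlim (x : ℝ) : Tendsto (fun n : ℕ => Real.exp (-(x + n * b) ^ 2)) atTop (𝓝 0) := by
    refine Real.tendsto_exp_atBot.comp (tendsto_neg_atTop_atBot.comp ?_)
    have h1 : Tendsto (fun n : ℕ => |(n : ℝ) * b| - |x|) atTop atTop := by
      refine tendsto_atTop_add_const_right _ _ ?_
      simp_rw [abs_mul, Nat.abs_cast]
      exact tendsto_natCast_atTop_atTop.atTop_mul_const (abs_pos.2 hb)
    have h2 : Tendsto (fun n : ℕ => |x + n * b|) atTop atTop := by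
      refine tendsto_atTop_mono (fun n => ?_) h1
      have := abs_sub (x + n * b) x
      rw [add_sub_cancel_left] at this
      linarith
    simpa [sq_abs, Function.comp_def] using (tendsto_pow_atTop (two_ne_zero)).comp h2
  have h1 : Tendsto (fun n : ℕ => ∫ x, Real.exp (-(x + n * b) ^ 2) ∂μ) atTop
      (𝓝 (∫ _, (0 : ℝ) ∂μ)) := by
    refine tendsto_integral_of_dominated_convergence (fun _ => 1)
      (fun n => Continuous.aestronglyMeasurable (by fun_prop)) (integrable_const _)
      (fun n => .of_forall fun x => ?_) (.of_forall hlim)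
    rw [Real.norm_eq_abs, Real.abs_exp, Real.exp_le_one_iff]
    nlinarith
  have h2 (n : ℕ) : ∫ x, Real.exp (-(x + n * b) ^ 2) ∂μ = ∫ x, Real.exp (-x ^ 2) ∂μ := by
    conv_rhs => rw [← hn n]
    rw [integral_map (by fun_prop) (Continuous.aestronglyMeasurable (by fun_prop))]
  simp_rw [h2, integral_zero] at h1
  have h3 := tendsto_nhds_unique tendsto_const_nhds h1
  have h4 : 0 < ∫ x, Real.exp (-x ^ 2) ∂μ := by
    refine integral_exp_pos (Integrable.mono' (integrable_const 1)
      (Continuous.aestronglyMeasurable (by fun_prop)) (.of_forall fun x => ?_))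
    rw [Real.norm_eq_abs, Real.abs_exp, Real.exp_le_one_iff]
    nlinarith
  linarith

variable {Ω : Type*} [MeasurableSpace Ω] {P : Measure Ω} {A B : Ω → ℝ}

/-- If one preserving map has slope of modulus other than `0` and `1`, the measure is a point mass,
and its atom is fixed by every preserving map. Otherwise the maps are the identity or reflections,
and the reflections share their centre. -/
lemma exists_fixedPoint_of_ae_map_affine_eq (hA0 : ∀ᵐ ω ∂P, A ω ≠ 0)
    (h : ∀ᵐ ω ∂P, μ.map (fun x => A ω * x + B ω) = μ) : ∃ c, ∀ᵐ ω ∂P, A ω * c + B ω = c := by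
  by_cases hex : ∃ ω, A ω ≠ 0 ∧ |A ω| ≠ 1 ∧ μ.map (fun x => A ω * x + B ω) = μ
  · obtain ⟨ω₀, h1, h2, h3⟩ := hex
    obtain ⟨c, rfl⟩ := exists_eq_dirac_of_map_affine_eq h1 h2 h3
    refine ⟨c, h.mono fun ω hω => ?_⟩
    rw [Measure.map_dirac' (show Measurable fun x => A ω * x + B ω by fun_prop)] at hω
    exact dirac_eq_dirac_iff.1 hω
  · push Not at hex
    have habs : ∀ᵐ ω ∂P, A ω = 1 ∨ A ω = -1 := by
      filter_upwards [hA0, h] with ω h1 h2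
      have : |A ω| = 1 := by
        by_contra h3
        exact hex ω h1 h3 h2
      exact eq_or_eq_neg_of_abs_eq this
    have hone : ∀ ω, A ω = 1 → μ.map (fun x => A ω * x + B ω) = μ → B ω = 0 := fun ω h1 h2 => by
      simp only [h1, one_mul] at h2
      exact eq_zero_of_map_add_eq h2
    by_cases hneg : ∃ ω, A ω = -1 ∧ μ.map (fun x => A ω * x + B ω) = μ
    · obtain ⟨ω₁, h1, h2⟩ := hneg
      refine ⟨B ω₁ / 2, ?_⟩
      filter_upwards [habs, h] with ω h3 h4
      rcases h3 with h3 | h3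
      · rw [hone ω h3 h4, h3]; ring
      -- Two reflections compose to a translation preserving `μ`, which must be trivial.
      · have h5 : μ.map (fun x => x + (B ω - B ω₁)) = μ := by
          conv_rhs => rw [← h4, ← h2]
          rw [Measure.map_map (by fun_prop) (by fun_prop)]
          congr 1
          ext x
          simp only [Function.comp_apply, h1, h3]
          ring
        have := eq_zero_of_map_add_eq h5
        rw [h3]
        linarith
    · push Not at hneg
      refine ⟨0, ?_⟩
      filter_upwards [habs, h] with ω h3 h4
      rcases h3 with h3 | h3
      · rw [hone ω h3 h4]; ring
      · exact absurd h4 (hneg ω h3)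

variable [IsProbabilityMeasure P]

/-- Used for `Z = exp(itB) ψ(At)`, whose mean is `ψ(t)`: nonnegativity of the variance gives the
mean inequality, its vanishing gives almost sure equality. -/
lemma integral_norm_sub_sq_eq {Z : Ω → ℂ} (hZm : AEStronglyMeasurable Z P)
    (hZ : ∀ ω, ‖Z ω‖ ≤ 1) {m : ℂ} (hm : ∫ ω, Z ω ∂P = m) :
    ∫ ω, ‖Z ω - m‖ ^ 2 ∂P = (∫ ω, ‖Z ω‖ ^ 2 ∂P) - ‖m‖ ^ 2 := by
  have hi : Integrable Z P := (integrable_const (1 : ℝ)).mono' hZm (.of_forall hZ)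
  have hi2 : Integrable (fun ω => ‖Z ω‖ ^ 2) P :=
    (integrable_const (1 : ℝ)).mono' (hZm.norm.pow 2) (.of_forall fun ω => by
      rw [Real.norm_eq_abs, abs_of_nonneg (by positivity)]
      exact pow_le_one₀ (norm_nonneg _) (hZ ω))
  have hin : Integrable (fun ω => inner ℝ m (Z ω)) P := hi.const_inner m
  have hexp (ω : Ω) : ‖Z ω - m‖ ^ 2 = ‖Z ω‖ ^ 2 - 2 * inner ℝ m (Z ω) + ‖m‖ ^ 2 := by
    rw [norm_sub_sq_real, real_inner_comm]
  simp_rw [hexp]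
  rw [integral_add (f := fun ω => ‖Z ω‖ ^ 2 - 2 * inner ℝ m (Z ω))
      (hi2.sub (hin.const_mul 2)) (integrable_const _),
    integral_sub hi2 (hin.const_mul 2), integral_const_mul, integral_inner hi, hm]
  simp
  ring

/-- If a probability measure is stationary for the random affine map `x ↦ A x + B`, where
`E log |A| ≥ 0`, then almost every one of the maps preserves it. -/
theorem ae_map_affine_eq_of_stationary (hAm : Measurable A) (hBm : Measurable B)
    (hlog : LogMeanNonneg A P)
    (hinv : (P.prod μ).map (fun p : Ω × ℝ => A p.1 * p.2 + B p.1) = μ) :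
    ∀ᵐ ω ∂P, μ.map (fun x => A ω * x + B ω) = μ := by
  obtain ⟨hA0, hint, hmean⟩ := hlog
  have hch : Continuous (charFun μ) := continuous_charFun
  have hchm := hch.measurable
  have hbound (t : ℝ) (ω : Ω) :
      ‖Complex.exp (t * B ω * Complex.I) * charFun μ (A ω * t)‖ = ‖charFun μ (A ω * t)‖ := by
    rw [norm_mul]
    have := Complex.norm_exp_ofReal_mul_I (t * B ω)
    push_cast at this
    rw [this, one_mul]
  have hmeasZ (t : ℝ) :
      Measurable fun ω => Complex.exp (t * B ω * Complex.I) * charFun μ (A ω * t) := by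
    fun_prop
  have hEZ (t : ℝ) :
      ∫ ω, Complex.exp (t * B ω * Complex.I) * charFun μ (A ω * t) ∂P = charFun μ t := by
    conv_rhs => rw [← hinv, charFun_apply_real, integral_map (by fun_prop)
      (Continuous.aestronglyMeasurable (by fun_prop))]
    rw [integral_prod]
    · refine integral_congr_ae (.of_forall fun ω => ?_)
      simp only
      rw [← charFun_map_affine, charFun_apply_real,
        integral_map (by fun_prop) (Continuous.aestronglyMeasurable (by fun_prop))]
    · refine (integrable_const (1 : ℝ)).mono' (Measurable.aestronglyMeasurable (by fun_prop))
        (.of_forall fun p => ?_)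
      have := Complex.norm_exp_ofReal_mul_I (t * (A p.1 * p.2 + B p.1))
      push_cast at this ⊢
      exact this.le
  have hvar (t : ℝ) :
      ∫ ω, ‖Complex.exp (t * B ω * Complex.I) * charFun μ (A ω * t) - charFun μ t‖ ^ 2 ∂P
        = (∫ ω, ‖charFun μ (A ω * t)‖ ^ 2 ∂P) - ‖charFun μ t‖ ^ 2 := by
    rw [integral_norm_sub_sq_eq (hmeasZ t).aestronglyMeasurable
      (fun ω => (hbound t ω).trans_le (norm_charFun_le_one _)) (hEZ t)]
    simp_rw [hbound]
  have hsq_int (t : ℝ) : Integrable (fun ω => ‖charFun μ (A ω * t)‖ ^ 2) P :=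
    (integrable_const (1 : ℝ)).mono' (Measurable.aestronglyMeasurable (by fun_prop))
      (.of_forall fun ω => by
        rw [Real.norm_eq_abs, abs_of_nonneg (by positivity)]
        exact pow_le_one₀ (norm_nonneg _) (norm_charFun_le_one _))
  have hnorm_abs (t : ℝ) (a : ℝ) : ‖charFun μ (|a| * t)‖ = ‖charFun μ (a * t)‖ := by
    rcases abs_cases a with ⟨h, _⟩ | ⟨h, _⟩
    · rw [h]
    · rw [h, neg_mul, charFun_neg, RCLike.norm_conj]
  have hshift (t s : ℝ) :
      ∫ ω, (1 - ‖charFun μ (t * Real.exp (s + Real.log |A ω|))‖ ^ 2) ∂P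
        = ∫ ω, (1 - ‖charFun μ (A ω * (t * Real.exp s))‖ ^ 2) ∂P := by
    refine integral_congr_ae (hA0.mono fun ω hω => ?_)
    simp only
    rw [Real.exp_add, Real.exp_log (abs_pos.2 hω), ← hnorm_abs _ (A ω)]
    ring_nf
  have hone (t : ℝ) : ∫ ω, (1 - ‖charFun μ (A ω * t)‖ ^ 2) ∂P
      = 1 - ∫ ω, ‖charFun μ (A ω * t)‖ ^ 2 ∂P := by
    rw [integral_sub (integrable_const _) (hsq_int t)]
    simp
  -- On the logarithmic scale, multiplication by `|A|` is the shift by `log |A|`, and the sign of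
  -- `A` is irrelevant since `|ψ|` is even. The function vanishes at `-∞` because `ψ(0) = 1`; the
  -- case `s = 0` is the claim.
  have heq (t : ℝ) : ∫ ω, ‖charFun μ (A ω * t)‖ ^ 2 ∂P = ‖charFun μ t‖ ^ 2 := by
    have h := mean_shift_eq_of_mean_shift_le (P := P)
      (U := fun s => 1 - ‖charFun μ (t * Real.exp s)‖ ^ 2) (ξ := fun ω => Real.log |A ω|)
      (by fun_prop)
      (fun s => sub_nonneg.2 (pow_le_one₀ (norm_nonneg _) (norm_charFun_le_one _)))
      (fun s => sub_le_self _ (by positivity)) ?_ (by fun_prop) hint hmean ?_ 0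
    · simp only [hshift, hone] at h
      simpa using h
    · have h1 : Tendsto (fun s => 1 - ‖charFun μ (t * Real.exp s)‖ ^ 2) atBot
          (𝓝 (1 - ‖charFun μ (t * 0)‖ ^ 2)) := by
        refine Tendsto.const_sub _ (Tendsto.pow (Tendsto.norm ?_) 2)
        exact (hch.tendsto _).comp (Real.tendsto_exp_atBot.const_mul t)
      simpa using h1
    · intro s
      simp only [hshift, hone]
      have h2 := hvar (t * Real.exp s)
      have h3 : 0 ≤ ∫ ω, ‖Complex.exp (↑(t * Real.exp s) * B ω * Complex.I)
          * charFun μ (A ω * (t * Real.exp s)) - charFun μ (t * Real.exp s)‖ ^ 2 ∂P :=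
        integral_nonneg fun ω => by positivity
      linarith
  have hae (t : ℝ) : ∀ᵐ ω ∂P,
      Complex.exp (t * B ω * Complex.I) * charFun μ (A ω * t) = charFun μ t := by
    have h1 := hvar t
    rw [heq, sub_self] at h1
    rw [integral_eq_zero_iff_of_nonneg (fun ω => by positivity)] at h1
    · filter_upwards [h1] with ω hω
      simpa [sub_eq_zero] using hω
    · refine (integrable_const (4 : ℝ)).mono' (Measurable.aestronglyMeasurable
        (((hmeasZ t).sub_const _).norm.pow_const 2)) (.of_forall fun ω => ?_)
      rw [Real.norm_eq_abs, abs_of_nonneg (by positivity)]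
      have h2 := norm_sub_le (Complex.exp (t * B ω * Complex.I) * charFun μ (A ω * t))
        (charFun μ t)
      rw [hbound] at h2
      nlinarith [norm_charFun_le_one (μ := μ) (A ω * t), norm_charFun_le_one (μ := μ) t,
        norm_nonneg (Complex.exp (t * B ω * Complex.I) * charFun μ (A ω * t) - charFun μ t)]
  -- The null set depends on `t`; rational `t` give a single one, and continuity of characteristic
  -- functions does the rest.
  have hq : ∀ᵐ ω ∂P, ∀ q : ℚ,
      Complex.exp (((q : ℝ) : ℂ) * B ω * Complex.I) * charFun μ (A ω * (q : ℝ))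
        = charFun μ (q : ℝ) := ae_all_iff.2 fun q => hae q
  filter_upwards [hq] with ω hω
  have : IsProbabilityMeasure (μ.map fun x => A ω * x + B ω) :=
    Measure.isProbabilityMeasure_map (by fun_prop)
  refine Measure.ext_of_charFun ?_
  refine Continuous.ext_on Rat.denseRange_cast continuous_charFun hch ?_
  rintro _ ⟨q, rfl⟩
  rw [charFun_map_affine]
  exact hω q

/-- A random affine map `x ↦ A x + B` with `E log |A| ≥ 0` has a stationary probability measure
only if its realizations have a common fixed point. -/
theorem exists_fixedPoint_of_stationary (hAm : Measurable A) (hBm : Measurable B)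
    (hlog : LogMeanNonneg A P)
    (hinv : (P.prod μ).map (fun p : Ω × ℝ => A p.1 * p.2 + B p.1) = μ) :
    ∃ c, ∀ᵐ ω ∂P, A ω * c + B ω = c :=
  exists_fixedPoint_of_ae_map_affine_eq hlog.1 (ae_map_affine_eq_of_stationary hAm hBm hlog hinv)

end AffineInvariance

/-! ### Vague limits of Cesàro means of laws -/

section VagueLimit

/-- The Cesàro mean of the integrals of `f` against the first `n` measures of a sequence. -/
noncomputable def cesaroMean (ν : ℕ → Measure ℝ) (f : ℝ → ℝ) (n : ℕ) : ℝ :=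
  (n : ℝ)⁻¹ * ∑ k ∈ Finset.range n, ∫ x, f x ∂ν k

/-- A continuous cutoff function, equal to `1` on `[-m, m]` and to `0` off `[-(m + 1), m + 1]`. -/
noncomputable def cutoff (m : ℕ) (x : ℝ) : ℝ := max 0 (min 1 (m + 1 - |x|))

lemma continuous_cutoff (m : ℕ) : Continuous (cutoff m) := by unfold cutoff; fun_prop

lemma cutoff_nonneg (m : ℕ) (x : ℝ) : 0 ≤ cutoff m x := le_max_left _ _

lemma cutoff_le_one (m : ℕ) (x : ℝ) : cutoff m x ≤ 1 := max_le zero_le_one (min_le_left _ _)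

lemma cutoff_eq_one {m : ℕ} {x : ℝ} (h : |x| ≤ m) : cutoff m x = 1 := by
  unfold cutoff
  rw [min_eq_left (by linarith), max_eq_right zero_le_one]

lemma hasCompactSupport_cutoff (m : ℕ) : HasCompactSupport (cutoff m) := by
  refine HasCompactSupport.intro (isCompact_closedBall (0 : ℝ) (m + 1)) fun x hx => ?_
  have h1 : (m : ℝ) + 1 < |x| := by simpa using hx
  unfold cutoff
  exact max_eq_left ((min_le_right _ _).trans (by linarith))

lemma tendsto_cutoff (x : ℝ) : Tendsto (fun m => cutoff m x) atTop (𝓝 1) := by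
  obtain ⟨m₀, hm₀⟩ := exists_nat_ge |x|
  refine tendsto_const_nhds.congr' ((eventually_ge_atTop m₀).mono fun m hm => ?_)
  exact (cutoff_eq_one (hm₀.trans (by exact_mod_cast hm))).symm

lemma integrable_of_continuous_of_bound {κ : Measure ℝ} [IsFiniteMeasure κ] {f : ℝ → ℝ} {C : ℝ}
    (hf : Continuous f) (hC : ∀ x, |f x| ≤ C) : Integrable f κ :=
  (integrable_const C).mono' hf.aestronglyMeasurable (.of_forall hC)

variable {ν : ℕ → Measure ℝ}

lemma cesaroMean_add {f g : ℝ → ℝ} (hf : ∀ k, Integrable f (ν k))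
    (hg : ∀ k, Integrable g (ν k)) (n : ℕ) :
    cesaroMean ν (f + g) n = cesaroMean ν f n + cesaroMean ν g n := by
  unfold cesaroMean
  rw [← mul_add, ← Finset.sum_add_distrib]
  congr 1
  exact Finset.sum_congr rfl fun k _ => integral_add (hf k) (hg k)

lemma cesaroMean_smul (c : ℝ) (f : ℝ → ℝ) (n : ℕ) :
    cesaroMean ν (c • f) n = c * cesaroMean ν f n := by
  unfold cesaroMean
  rw [mul_left_comm, Finset.mul_sum _ _ c]
  congr 1
  exact Finset.sum_congr rfl fun k _ => integral_const_mul _ _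

lemma cesaroMean_mono {f g : ℝ → ℝ} (hf : ∀ k, Integrable f (ν k))
    (hg : ∀ k, Integrable g (ν k)) (h : ∀ x, f x ≤ g x) (n : ℕ) :
    cesaroMean ν f n ≤ cesaroMean ν g n :=
  mul_le_mul_of_nonneg_left (Finset.sum_le_sum fun k _ => integral_mono (hf k) (hg k) h)
    (by positivity)

variable [∀ k, IsProbabilityMeasure (ν k)]

lemma abs_cesaroMean_le {f : ℝ → ℝ} {C : ℝ} (hC : ∀ x, |f x| ≤ C) (n : ℕ) :
    |cesaroMean ν f n| ≤ C := by
  have hC0 : 0 ≤ C := (abs_nonneg _).trans (hC 0)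
  have h1 (k : ℕ) : |∫ x, f x ∂ν k| ≤ C := by
    simpa using norm_integral_le_of_norm_le_const (μ := ν k) (f := f) (.of_forall hC)
  unfold cesaroMean
  rw [abs_mul, abs_inv, Nat.abs_cast]
  have h2 : |∑ k ∈ Finset.range n, ∫ x, f x ∂ν k| ≤ n * C := by
    refine (Finset.abs_sum_le_sum_abs _ _).trans ((Finset.sum_le_sum fun k _ => h1 k).trans ?_)
    simp
  rcases Nat.eq_zero_or_pos n with rfl | hn
  · simpa using hC0
  · rw [inv_mul_le_iff₀ (by positivity)]
    exact h2

/-- The limit of the Cesàro means along an ultrafilter. -/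
noncomputable def cesaroLimit (𝒰 : Ultrafilter ℕ) (ν : ℕ → Measure ℝ) (f : ℝ → ℝ) : ℝ :=
  limUnder (𝒰 : Filter ℕ) (cesaroMean ν f)

lemma tendsto_cesaroLimit (𝒰 : Ultrafilter ℕ) {f : ℝ → ℝ} {C : ℝ} (hC : ∀ x, |f x| ≤ C) :
    Tendsto (cesaroMean ν f) 𝒰 (𝓝 (cesaroLimit 𝒰 ν f)) := by
  have h := (isCompact_Icc (a := -C) (b := C)).ultrafilter_le_nhds (𝒰.map (cesaroMean ν f)) (by
    rw [le_principal_iff, Ultrafilter.coe_map]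
    exact mem_map.2 (Filter.univ_mem' fun n => abs_le.1 (abs_cesaroMean_le hC n)))
  obtain ⟨a, -, ha⟩ := h
  exact tendsto_nhds_limUnder ⟨a, ha⟩

lemma exists_bound_of_hasCompactSupport {f : ℝ → ℝ} (hf : Continuous f)
    (hs : HasCompactSupport f) : ∃ C, ∀ x, |f x| ≤ C :=
  hs.exists_bound_of_continuous hf

/-- The Cesàro limits along an ultrafilter of functions with compact support are the integrals
against a regular measure of mass at most one. -/
lemma exists_measure_eq_cesaroLimit (𝒰 : Ultrafilter ℕ) :
    ∃ μ : Measure ℝ, μ.Regular ∧ IsFiniteMeasure μ ∧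
      ∀ f : ℝ → ℝ, Continuous f → HasCompactSupport f →
        ∫ x, f x ∂μ = cesaroLimit 𝒰 ν f := by
  have hbd (f : C_c(ℝ, ℝ)) : ∃ C, ∀ x, |f x| ≤ C :=
    exists_bound_of_hasCompactSupport f.continuous f.hasCompactSupport
  have hint (f : C_c(ℝ, ℝ)) (k : ℕ) : Integrable f (ν k) :=
    integrable_of_continuous_of_bound f.continuous (hbd f).choose_spec
  have hlim (f : C_c(ℝ, ℝ)) : Tendsto (cesaroMean ν f) 𝒰 (𝓝 (cesaroLimit 𝒰 ν f)) :=
    tendsto_cesaroLimit 𝒰 (hbd f).choose_spec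
  let Λ : C_c(ℝ, ℝ) →ₚ[ℝ] ℝ :=
    { toFun f := cesaroLimit 𝒰 ν f
      map_add' f g := by
        refine tendsto_nhds_unique (hlim (f + g)) (((hlim f).add (hlim g)).congr fun n => ?_)
        exact (cesaroMean_add (hint f) (hint g) n).symm
      map_smul' c f := by
        refine tendsto_nhds_unique (hlim (c • f)) (((hlim f).const_mul c).congr fun n => ?_)
        exact (cesaroMean_smul c f n).symm
      monotone' f g hfg := le_of_tendsto_of_tendsto' (hlim f) (hlim g) fun n =>
        cesaroMean_mono (hint f) (hint g) hfg n }
  refine ⟨RealRMK.rieszMeasure Λ, inferInstance, ⟨?_⟩, fun f hf hs => ?_⟩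
  · have hball (m : ℕ) : RealRMK.rieszMeasure Λ (Metric.closedBall 0 m) ≤ 1 := by
      refine (RealRMK.rieszMeasure_le_of_eq_one Λ
        (f := ⟨⟨cutoff m, continuous_cutoff m⟩, hasCompactSupport_cutoff m⟩)
        (fun x => cutoff_nonneg m x) (isCompact_closedBall _ _)
        (fun x hx => cutoff_eq_one (by simpa using hx))).trans ?_
      refine ENNReal.ofReal_le_one.2 (le_of_tendsto' (hlim _) fun n => ?_)
      exact (abs_le.1 (abs_cesaroMean_le (C := 1) (fun x => by
        have h0 := cutoff_nonneg m x
        exact (abs_of_nonneg h0).trans_le (cutoff_le_one m x)) n)).2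
    have hmono : Monotone fun m : ℕ => Metric.closedBall (0 : ℝ) m := fun m m' h =>
      Metric.closedBall_subset_closedBall (by exact_mod_cast h)
    have h1 := hmono.measure_iUnion (μ := RealRMK.rieszMeasure Λ)
    rw [Metric.iUnion_closedBall_nat] at h1
    rw [h1]
    exact (iSup_le hball).trans_lt ENNReal.one_lt_top
  · exact RealRMK.integral_rieszMeasure Λ ⟨⟨f, hf⟩, hs⟩

variable {Ω : Type*} [MeasurableSpace Ω] {P : Measure Ω} [IsProbabilityMeasure P] {A B : Ω → ℝ}

/-- The law of `A x + B` when `x` has the law `κ` and is independent of `(A, B)`. -/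
noncomputable def affineStep (P : Measure Ω) (A B : Ω → ℝ) (κ : Measure ℝ) : Measure ℝ :=
  (P.prod κ).map fun p : Ω × ℝ => A p.1 * p.2 + B p.1

/-- The mean of `f (A x + B)`. -/
noncomputable def affineMean (P : Measure Ω) (A B : Ω → ℝ) (f : ℝ → ℝ) (x : ℝ) : ℝ :=
  ∫ ω, f (A ω * x + B ω) ∂P

lemma continuous_affineMean (hA : Measurable A) (hB : Measurable B) {f : ℝ → ℝ}
    (hf : Continuous f) {C : ℝ} (hC : ∀ x, |f x| ≤ C) : Continuous (affineMean P A B f) := by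
  have := hf.measurable
  exact continuous_of_dominated (bound := fun _ => C)
    (fun s => Measurable.aestronglyMeasurable (by fun_prop))
    (fun s => .of_forall fun ω => hC _) (integrable_const _) (.of_forall fun ω => by fun_prop)

lemma abs_affineMean_le {f : ℝ → ℝ} {C : ℝ} (hC : ∀ x, |f x| ≤ C) (x : ℝ) :
    |affineMean P A B f x| ≤ C := by
  simpa [affineMean] using norm_integral_le_of_norm_le_const (μ := P) (f := fun ω => f (A ω * x + B ω))
    (.of_forall fun ω => hC _)

lemma integral_affineStep (hA : Measurable A) (hB : Measurable B) {f : ℝ → ℝ}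
    (hf : Continuous f) {C : ℝ} (hC : ∀ x, |f x| ≤ C) (κ : Measure ℝ) [IsFiniteMeasure κ] :
    ∫ x, f x ∂(affineStep P A B κ) = ∫ x, affineMean P A B f x ∂κ := by
  have := hf.measurable
  unfold affineStep affineMean
  rw [integral_map (by fun_prop) hf.aestronglyMeasurable, integral_prod_symm]
  exact (integrable_const C).mono' (Measurable.aestronglyMeasurable (by fun_prop))
    (.of_forall fun p => hC _)

/-- The averaged laws are asymptotically invariant, since one step changes the Cesàro mean by at
most `2C / n`. As the mean of `f (A x + B)` need not have compact support, mass lost at infinity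
leaves only an inequality, obtained through cutoffs. -/
lemma integral_affineMean_le_of_nonneg (hA : Measurable A) (hB : Measurable B)
    (hν : ∀ k, affineStep P A B (ν k) = ν (k + 1)) {𝒰 : Ultrafilter ℕ} (h𝒰 : (𝒰 : Filter ℕ) ≤ atTop)
    {μ : Measure ℝ} [IsFiniteMeasure μ]
    (hμ : ∀ f : ℝ → ℝ, Continuous f → HasCompactSupport f → ∫ x, f x ∂μ = cesaroLimit 𝒰 ν f)
    {f : ℝ → ℝ} (hf : Continuous f) (hs : HasCompactSupport f) (hf0 : ∀ x, 0 ≤ f x) :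
    ∫ x, affineMean P A B f x ∂μ ≤ ∫ x, f x ∂μ := by
  obtain ⟨C, hC⟩ := exists_bound_of_hasCompactSupport hf hs
  have hT := continuous_affineMean (P := P) hA hB hf hC
  have hTC := abs_affineMean_le (P := P) (A := A) (B := B) hC
  have hT0 (x : ℝ) : 0 ≤ affineMean P A B f x := integral_nonneg fun ω => hf0 _
  have hstep : cesaroLimit 𝒰 ν (affineMean P A B f) = cesaroLimit 𝒰 ν f := by
    have h1 : Tendsto (fun n : ℕ => (n : ℝ)⁻¹ * (∫ x, f x ∂ν n - ∫ x, f x ∂ν 0)) 𝒰 (𝓝 0) := by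
      refine Tendsto.mono_left ?_ h𝒰
      refine squeeze_zero_norm (a := fun n : ℕ => (n : ℝ)⁻¹ * (2 * C)) (fun n => ?_) ?_
      · rw [norm_mul, norm_inv, Real.norm_natCast]
        refine mul_le_mul_of_nonneg_left ?_ (by positivity)
        have hb (k : ℕ) : ‖∫ x, f x ∂ν k‖ ≤ C := by
          simpa using norm_integral_le_of_norm_le_const (μ := ν k) (f := f) (.of_forall hC)
        exact (norm_sub_le _ _).trans (by linarith [hb n, hb 0])
      · simpa using (tendsto_inv_atTop_nhds_zero_nat (𝕜 := ℝ)).mul_const (2 * C)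
    have h2 (n : ℕ) : cesaroMean ν (affineMean P A B f) n
        = cesaroMean ν f n + (n : ℝ)⁻¹ * (∫ x, f x ∂ν n - ∫ x, f x ∂ν 0) := by
      unfold cesaroMean
      rw [← mul_add]
      congr 1
      rw [← Finset.sum_range_sub (fun k => ∫ x, f x ∂ν k), ← Finset.sum_add_distrib]
      refine Finset.sum_congr rfl fun k _ => ?_
      rw [← integral_affineStep hA hB hf hC, hν]
      ring
    refine tendsto_nhds_unique (tendsto_cesaroLimit 𝒰 hTC) ?_
    simpa [funext h2] using (tendsto_cesaroLimit (ν := ν) 𝒰 hC).add h1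
  have hm (m : ℕ) : ∫ x, cutoff m x * affineMean P A B f x ∂μ ≤ ∫ x, f x ∂μ := by
    have hcont : Continuous fun x => cutoff m x * affineMean P A B f x :=
      (continuous_cutoff m).mul hT
    have hb (x : ℝ) : |cutoff m x * affineMean P A B f x| ≤ C := by
      rw [abs_mul, abs_of_nonneg (cutoff_nonneg m x)]
      exact (mul_le_of_le_one_left (abs_nonneg _) (cutoff_le_one m x)).trans (hTC x)
    rw [hμ _ hcont (hasCompactSupport_cutoff m).mul_right, hμ _ hf hs, ← hstep]
    refine le_of_tendsto_of_tendsto' (tendsto_cesaroLimit 𝒰 hb) (tendsto_cesaroLimit 𝒰 hTC)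
      fun n => cesaroMean_mono (fun k => integrable_of_continuous_of_bound hcont hb)
        (fun k => integrable_of_continuous_of_bound hT hTC) (fun x => ?_) n
    exact mul_le_of_le_one_left (hT0 x) (cutoff_le_one m x)
  refine le_of_tendsto' (x := atTop) ?_ hm
  refine tendsto_integral_of_dominated_convergence (fun _ => C)
    (fun m => ((continuous_cutoff m).mul hT).aestronglyMeasurable) (integrable_const _)
    (fun m => .of_forall fun x => ?_) (.of_forall fun x => ?_)
  · rw [norm_mul, Real.norm_eq_abs, abs_of_nonneg (cutoff_nonneg m x)]
    exact (mul_le_of_le_one_left (abs_nonneg _) (cutoff_le_one m x)).trans (hTC x)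
  · simpa using (tendsto_cutoff x).mul_const (affineMean P A B f x)

lemma tendsto_integral_cutoff (κ : Measure ℝ) [IsFiniteMeasure κ] (C : ℝ) :
    Tendsto (fun m => ∫ x, C * cutoff m x ∂κ) atTop (𝓝 (κ.real Set.univ * C)) := by
  have h : κ.real Set.univ * C = ∫ _, C ∂κ := by simp
  rw [h]
  refine tendsto_integral_of_dominated_convergence (fun _ => |C|)
    (fun m => ((continuous_cutoff m).const_mul C).aestronglyMeasurable) (integrable_const _)
    (fun m => .of_forall fun x => ?_) (.of_forall fun x => ?_)
  · rw [norm_mul, Real.norm_eq_abs, Real.norm_eq_abs, abs_of_nonneg (cutoff_nonneg m x)]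
    exact mul_le_of_le_one_right (abs_nonneg _) (cutoff_le_one m x)
  · simpa using (tendsto_cutoff x).const_mul C

/-- A vague limit of the Cesàro means of the laws of the chain `x ↦ A x + B` is stationary. -/
lemma affineStep_eq_of_cesaroLimit (hA : Measurable A) (hB : Measurable B)
    (hν : ∀ k, affineStep P A B (ν k) = ν (k + 1)) {𝒰 : Ultrafilter ℕ} (h𝒰 : (𝒰 : Filter ℕ) ≤ atTop)
    {μ : Measure ℝ} [μ.Regular] [IsFiniteMeasure μ]
    (hμ : ∀ f : ℝ → ℝ, Continuous f → HasCompactSupport f → ∫ x, f x ∂μ = cesaroLimit 𝒰 ν f) :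
    affineStep P A B μ = μ := by
  have hfin : IsFiniteMeasure (affineStep P A B μ) := by unfold affineStep; infer_instance
  have hmass : (affineStep P A B μ).real Set.univ = μ.real Set.univ := by
    unfold affineStep
    rw [map_measureReal_apply (by fun_prop) MeasurableSet.univ, Set.preimage_univ,
      ← Set.univ_prod_univ, measureReal_prod_prod]
    simp
  have hle {f : ℝ → ℝ} (hf : Continuous f) (hs : HasCompactSupport f) (hf0 : ∀ x, 0 ≤ f x) :
      ∫ x, f x ∂(affineStep P A B μ) ≤ ∫ x, f x ∂μ := by
    rw [integral_affineStep hA hB hf (exists_bound_of_hasCompactSupport hf hs).choose_spec]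
    exact integral_affineMean_le_of_nonneg hA hB hν h𝒰 hμ hf hs hf0
  -- Both measures have the same total mass, so applying the inequality to `C * cutoff m - f ≥ 0`
  -- and letting `m → ∞` reverses it.
  have hge {f : ℝ → ℝ} (hf : Continuous f) (hs : HasCompactSupport f) :
      ∫ x, f x ∂μ ≤ ∫ x, f x ∂(affineStep P A B μ) := by
    obtain ⟨C, hC⟩ := exists_bound_of_hasCompactSupport hf hs
    obtain ⟨r, hr⟩ := hs.isCompact.isBounded.subset_closedBall (0 : ℝ)
    obtain ⟨m₀, hm₀⟩ := exists_nat_ge r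
    have hdom (m : ℕ) (hm : m₀ ≤ m) (x : ℝ) : 0 ≤ C * cutoff m x - f x := by
      by_cases hx : x ∈ tsupport f
      · have h1 : |x| ≤ r := by simpa using hr hx
        have h2 : (m₀ : ℝ) ≤ m := by exact_mod_cast hm
        rw [cutoff_eq_one (by linarith)]
        have := (abs_le.1 (hC x)).2
        linarith
      · rw [image_eq_zero_of_notMem_tsupport hx, sub_zero]
        exact mul_nonneg ((abs_nonneg _).trans (hC 0)) (cutoff_nonneg m x)
    have hci (κ : Measure ℝ) [IsFiniteMeasure κ] (m : ℕ) :
        Integrable (fun x => C * cutoff m x) κ :=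
      (integrable_of_continuous_of_bound (continuous_cutoff m) (C := 1) (fun x => by
        rw [abs_of_nonneg (cutoff_nonneg m x)]; exact cutoff_le_one m x)).const_mul C
    have hfi (κ : Measure ℝ) [IsFiniteMeasure κ] : Integrable f κ :=
      integrable_of_continuous_of_bound hf hC
    have hm : ∀ᶠ m : ℕ in atTop,
        (∫ x, C * cutoff m x ∂(affineStep P A B μ)) - ∫ x, f x ∂(affineStep P A B μ)
          ≤ (∫ x, C * cutoff m x ∂μ) - ∫ x, f x ∂μ := by
      filter_upwards [eventually_ge_atTop m₀] with m hm
      rw [← integral_sub (hci _ m) (hfi _), ← integral_sub (hci _ m) (hfi _)]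
      exact hle (((continuous_cutoff m).const_mul C).sub hf)
        ((hasCompactSupport_cutoff m).mul_left.sub hs) (hdom m hm)
    have hl := le_of_tendsto_of_tendsto
      ((tendsto_integral_cutoff (affineStep P A B μ) C).sub_const _)
      ((tendsto_integral_cutoff μ C).sub_const _) hm
    rw [hmass] at hl
    linarith
  have : (affineStep P A B μ).Regular := inferInstance
  refine Measure.ext_of_integral_eq_on_compactlySupported fun f => le_antisymm ?_
    (hge f.continuous f.hasCompactSupport)
  have h := hge (f := fun x => -f x) f.continuous.neg f.hasCompactSupport.neg
  simp only [integral_neg] at h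
  linarith

/-- If the Cesàro means of the laws of the chain `x ↦ A x + B` do not escape to infinity, the chain
has a stationary probability measure. -/
theorem exists_stationary_of_not_tendsto_cesaroMean (hA : Measurable A) (hB : Measurable B)
    (hν : ∀ k, affineStep P A B (ν k) = ν (k + 1)) {f : ℝ → ℝ} (hf : Continuous f)
    (hs : HasCompactSupport f) (h : ¬ Tendsto (cesaroMean ν f) atTop (𝓝 0)) :
    ∃ μ : Measure ℝ, IsProbabilityMeasure μ ∧ affineStep P A B μ = μ := by
  rw [tendsto_iff_ultrafilter] at h
  push Not at h
  obtain ⟨𝒰, h𝒰, hnot⟩ := h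
  obtain ⟨μ, hreg, hfin, hμ⟩ := exists_measure_eq_cesaroLimit (ν := ν) 𝒰
  have hst := affineStep_eq_of_cesaroLimit hA hB hν h𝒰 hμ
  -- The ultrafilter was chosen so that the Cesàro means of `f` do not tend to `0` along it, so the
  -- vague limit retains some mass.
  have hne : μ ≠ 0 := by
    rintro rfl
    refine hnot ?_
    have h1 := hμ f hf hs
    rw [integral_zero_measure] at h1
    rw [h1]
    exact tendsto_cesaroLimit 𝒰 (exists_bound_of_hasCompactSupport hf hs).choose_spec
  have : NeZero μ := ⟨hne⟩
  refine ⟨(μ Set.univ)⁻¹ • μ, inferInstance, ?_⟩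
  unfold affineStep at hst ⊢
  rw [Measure.prod_smul_right, Measure.map_smul, hst]

end VagueLimit

/-! ### The random coefficient autoregressive process -/

section Recursion

variable {Ω : Type*}

/-- The `σ`-algebra generated by the vectors `(b j, e j)` with `j ≤ k`. -/
abbrev noisePast (b e : ℕ → Ω → ℝ) (k : ℕ) : MeasurableSpace Ω :=
  ⨆ j ≤ k, MeasurableSpace.comap (fun ω => (b j ω, e j ω)) inferInstance

lemma noisePast_mono (b e : ℕ → Ω → ℝ) {j k : ℕ} (h : j ≤ k) :
    noisePast b e j ≤ noisePast b e k :=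
  biSup_mono fun _ hi => hi.trans h

lemma measurable_noise_noisePast (b e : ℕ → Ω → ℝ) (k : ℕ) :
    Measurable[noisePast b e k] fun ω => (b k ω, e k ω) :=
  (comap_measurable _).mono (le_iSup₂_of_le k le_rfl le_rfl) le_rfl

lemma measurable_rca_noisePast (φ x₀ : ℝ) (b e : ℕ → Ω → ℝ) (k : ℕ) :
    Measurable[noisePast b e k] (rcaProcess φ x₀ b e k) := by
  induction k with
  | zero => exact measurable_const
  | succ k ih =>
    have h1 := measurable_noise_noisePast b e (k + 1)
    have h2 : Measurable[noisePast b e (k + 1)] (b (k + 1)) := measurable_fst.comp h1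
    have h3 : Measurable[noisePast b e (k + 1)] (e (k + 1)) := measurable_snd.comp h1
    have h4 := ih.mono (noisePast_mono b e k.le_succ) le_rfl
    exact ((h2.const_add φ).mul h4).add h3

variable [MeasurableSpace Ω] {P : Measure Ω} {b e : ℕ → Ω → ℝ}

/-- The vectors `(b k, e k)` are independent and identically distributed. -/
structure IsIIDNoise (P : Measure Ω) (b e : ℕ → Ω → ℝ) : Prop where
  measurable_fst : ∀ k, Measurable (b k)
  measurable_snd : ∀ k, Measurable (e k)
  indep : iIndepFun (fun k ω => (b k ω, e k ω)) P
  ident : ∀ k, IdentDistrib (fun ω => (b k ω, e k ω)) (fun ω => (b 0 ω, e 0 ω)) P P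

namespace IsIIDNoise

lemma measurable_pair (h : IsIIDNoise P b e) (k : ℕ) : Measurable fun ω => (b k ω, e k ω) :=
  (h.measurable_fst k).prodMk (h.measurable_snd k)

lemma noisePast_le (h : IsIIDNoise P b e) (k : ℕ) : noisePast b e k ≤ ‹MeasurableSpace Ω› :=
  iSup₂_le fun j _ => (h.measurable_pair j).comap_le

lemma measurable_rca (h : IsIIDNoise P b e) (φ x₀ : ℝ) (k : ℕ) :
    Measurable (rcaProcess φ x₀ b e k) :=
  (measurable_rca_noisePast φ x₀ b e k).mono (h.noisePast_le k) le_rfl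

/-- The next noise vector is independent of the past. -/
lemma indepFun_past (h : IsIIDNoise P b e) {β : Type*} [MeasurableSpace β] {Y : Ω → β} {k : ℕ}
    (hY : Measurable[noisePast b e k] Y) :
    IndepFun (fun ω => (b (k + 1) ω, e (k + 1) ω)) Y P := by
  have h1 := h.indep.indep_comap_natural_of_lt
    (fun i => (h.measurable_pair i).stronglyMeasurable) (Nat.lt_succ_self k)
  rw [IndepFun_iff_Indep]
  exact indep_of_indep_of_le_right h1 hY.comap_le

variable [IsProbabilityMeasure P]

/-- The next noise vector is independent of the current state and distributed like `(b 0, e 0)`, so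
the laws of the process form an orbit of one fixed Markov step. -/
lemma affineStep_map_rca (h : IsIIDNoise P b e) (φ x₀ : ℝ) (k : ℕ) :
    affineStep P (fun ω => φ + b 0 ω) (e 0) (P.map (rcaProcess φ x₀ b e k))
      = P.map (rcaProcess φ x₀ b e (k + 1)) := by
  have hX := h.measurable_rca φ x₀ k
  have := Measure.isProbabilityMeasure_map (μ := P) hX.aemeasurable
  have hind := h.indepFun_past (measurable_rca_noisePast φ x₀ b e k)
  rw [indepFun_iff_map_prod_eq_prod_map_map (h.measurable_pair _).aemeasurable hX.aemeasurable,
    (h.ident (k + 1)).map_eq] at hind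
  have hg : Measurable fun p : (ℝ × ℝ) × ℝ => (φ + p.1.1) * p.2 + p.1.2 := by fun_prop
  have h1 : P.map (rcaProcess φ x₀ b e (k + 1))
      = (P.map fun ω => ((b (k + 1) ω, e (k + 1) ω), rcaProcess φ x₀ b e k ω)).map
        fun p : (ℝ × ℝ) × ℝ => (φ + p.1.1) * p.2 + p.1.2 := by
    rw [Measure.map_map hg ((h.measurable_pair _).prodMk hX)]
    rfl
  rw [h1, hind]
  conv_rhs => rw [← Measure.map_id (μ := P.map (rcaProcess φ x₀ b e k))]
  rw [Measure.map_prod_map _ _ (h.measurable_pair 0) measurable_id,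
    Measure.map_map hg ((h.measurable_pair 0).prodMap measurable_id)]
  rfl

end IsIIDNoise

lemma memLp_two_of_integrable_pow_four [IsFiniteMeasure P] {f : Ω → ℝ} (hf : Measurable f)
    (h : Integrable (fun ω => f ω ^ 4) P) : MemLp f 2 P := by
  rw [memLp_two_iff_integrable_sq hf.aestronglyMeasurable]
  refine (h.add (integrable_const 1)).mono' (Measurable.aestronglyMeasurable (by fun_prop))
    (.of_forall fun ω => ?_)
  rw [Real.norm_eq_abs, abs_of_nonneg (by positivity)]
  simp only [Pi.add_apply]
  nlinarith [sq_nonneg (f ω ^ 2 - 1), sq_nonneg (f ω ^ 2)]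

/-- The second-order moment conditions on the noise. -/
structure NoiseMoments (P : Measure Ω) (β ε : Ω → ℝ) (w σ : ℝ) : Prop where
  memLp_fst : MemLp β 2 P
  memLp_snd : MemLp ε 2 P
  mean_fst : ∫ ω, β ω ∂P = 0
  mean_snd : ∫ ω, ε ω ∂P = 0
  var_fst : ∫ ω, β ω ^ 2 ∂P = w ^ 2
  var_snd : ∫ ω, ε ω ^ 2 ∂P = σ ^ 2
  cov : ∫ ω, β ω * ε ω ∂P = 0

/-- The maps `x ↦ (φ + β) x + ε` with uncorrelated nondegenerate `β` and `ε` have no common fixed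
point. -/
lemma NoiseMoments.not_ae_fixedPoint [IsProbabilityMeasure P] {β ε : Ω → ℝ} {w σ : ℝ} (h : NoiseMoments P β ε w σ)
    (hw : 0 < w) (hσ : 0 < σ) (φ c : ℝ) : ¬ ∀ᵐ ω ∂P, (φ + β ω) * c + ε ω = c := by
  intro hae
  have hε : ∀ᵐ ω ∂P, ε ω = c * (1 - φ - β ω) := by
    filter_upwards [hae] with ω hω
    linarith
  -- Multiplying `ε = c (1 - φ - β)` by `β` and taking means gives `0 = -c w²`.
  have hc : c = 0 := by
    have h1 : ∫ ω, β ω * ε ω ∂P = ∫ ω, (c * (1 - φ) * β ω - c * β ω ^ 2) ∂P := by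
      refine integral_congr_ae (hε.mono fun ω hω => ?_)
      simp only [hω]
      ring
    rw [integral_sub ((h.memLp_fst.integrable one_le_two).const_mul _)
        (h.memLp_fst.integrable_sq.const_mul _),
      integral_const_mul, integral_const_mul, h.cov, h.mean_fst, h.var_fst] at h1
    have : c * w ^ 2 = 0 := by linarith
    exact (mul_eq_zero.1 this).resolve_right (by positivity)
  have h2 : ∫ ω, ε ω ^ 2 ∂P = 0 := by
    rw [integral_eq_zero_of_ae]
    filter_upwards [hε] with ω hω
    simp [hω, hc]
  rw [h.var_snd] at h2
  exact absurd h2 (by positivity)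


/-- The process leaves every bounded set on average. -/
theorem IsIIDNoise.tendsto_average_inv_one_add_abs [IsProbabilityMeasure P] (h : IsIIDNoise P b e)
    {w σ φ : ℝ} (hm : NoiseMoments P (b 0) (e 0) w σ) (hw : 0 < w) (hσ : 0 < σ)
    (hlog : LogMeanNonneg (fun ω => φ + b 0 ω) P) (x₀ : ℝ) :
    Tendsto (fun n : ℕ => (n : ℝ)⁻¹ *
      ∑ k ∈ Finset.range n, ∫ ω, (1 + |(rcaProcess φ x₀ b e k ω)|)⁻¹ ∂P) atTop (𝓝 0) := by
  set X := rcaProcess φ x₀ b e with hX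
  have hXm := h.measurable_rca φ x₀
  have hprob (k : ℕ) : IsProbabilityMeasure (P.map (X k)) :=
    Measure.isProbabilityMeasure_map (hXm k).aemeasurable
  have hA : Measurable fun ω => φ + b 0 ω := (h.measurable_fst 0).const_add φ
  have hcut (m : ℕ) : Tendsto (cesaroMean (fun k => P.map (X k)) (cutoff m)) atTop (𝓝 0) := by
    by_contra hnot
    obtain ⟨μ, hμ, hst⟩ := exists_stationary_of_not_tendsto_cesaroMean hA (h.measurable_snd 0)
      (h.affineStep_map_rca φ x₀) (continuous_cutoff m) (hasCompactSupport_cutoff m) hnot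
    obtain ⟨c, hc⟩ := exists_fixedPoint_of_stationary hA (h.measurable_snd 0) hlog hst
    exact hm.not_ae_fixedPoint hw hσ φ c hc
  -- The weight lacks compact support, but up to an error of order `1 / m` it is dominated by a
  -- cutoff, whose Cesàro mean vanishes.
  have hle (m : ℕ) (x : ℝ) : (1 + |x|)⁻¹ ≤ cutoff m x + ((m : ℝ) + 1)⁻¹ := by
    have hx := abs_nonneg x
    by_cases hxm : |x| ≤ m
    · rw [cutoff_eq_one hxm]
      have h1 : (1 + |x|)⁻¹ ≤ 1 := inv_le_one_of_one_le₀ (by linarith)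
      have h2 : (0 : ℝ) < ((m : ℝ) + 1)⁻¹ := by positivity
      linarith
    · have h1 : (1 + |x|)⁻¹ ≤ ((m : ℝ) + 1)⁻¹ := inv_anti₀ (by positivity) (by linarith)
      linarith [cutoff_nonneg m x]
  have hqi (k : ℕ) : Integrable (fun ω => (1 + |X k ω|)⁻¹) P :=
    (integrable_const (1 : ℝ)).mono' (Measurable.aestronglyMeasurable (by
      have := hXm k; fun_prop)) (.of_forall fun ω => by
      rw [Real.norm_eq_abs, abs_of_nonneg (by positivity)]
      exact inv_le_one_of_one_le₀ (by linarith [abs_nonneg (X k ω)]))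
  have hci (m k : ℕ) : Integrable (fun ω => cutoff m (X k ω)) P :=
    (integrable_const (1 : ℝ)).mono'
      ((continuous_cutoff m).measurable.comp (hXm k)).aestronglyMeasurable (.of_forall fun ω => by
      rw [Real.norm_eq_abs, abs_of_nonneg (cutoff_nonneg _ _)]
      exact cutoff_le_one _ _)
  have hbound (m n : ℕ) : (n : ℝ)⁻¹ * ∑ k ∈ Finset.range n, ∫ ω, (1 + |X k ω|)⁻¹ ∂P
      ≤ cesaroMean (fun k => P.map (X k)) (cutoff m) n + ((m : ℝ) + 1)⁻¹ := by
    have h1 (k : ℕ) : ∫ ω, (1 + |X k ω|)⁻¹ ∂P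
        ≤ ∫ x, cutoff m x ∂(P.map (X k)) + ((m : ℝ) + 1)⁻¹ := by
      rw [integral_map (hXm k).aemeasurable (continuous_cutoff m).aestronglyMeasurable]
      have h2 := integral_mono (hqi k) ((hci m k).add (integrable_const _))
        (fun ω => hle m (X k ω))
      simp only [Pi.add_apply] at h2
      rw [integral_add (hci m k) (integrable_const _)] at h2
      simpa using h2
    unfold cesaroMean
    rcases Nat.eq_zero_or_pos n with rfl | hn
    · simp
      positivity
    · have hn' : (0 : ℝ) < n := by exact_mod_cast hn
      have h3 := Finset.sum_le_sum fun k (_ : k ∈ Finset.range n) => h1 k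
      rw [Finset.sum_add_distrib, Finset.sum_const, Finset.card_range, nsmul_eq_mul] at h3
      rw [inv_mul_le_iff₀ hn', mul_add, mul_inv_cancel_left₀ hn'.ne']
      exact h3
  rw [Metric.tendsto_atTop']
  intro δ hδ
  obtain ⟨m, hm⟩ := exists_nat_one_div_lt (half_pos hδ)
  obtain ⟨N, hN⟩ := eventually_atTop.1 ((hcut m).eventually_lt_const (half_pos hδ))
  refine ⟨N, fun n hn => ?_⟩
  have h0 : 0 ≤ (n : ℝ)⁻¹ * ∑ k ∈ Finset.range n, ∫ ω, (1 + |X k ω|)⁻¹ ∂P :=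
    mul_nonneg (by positivity) (Finset.sum_nonneg fun k _ => integral_nonneg fun ω => by positivity)
  rw [dist_zero_right, Real.norm_eq_abs, abs_of_nonneg h0]
  rw [one_div] at hm
  linarith [hbound m n, hN n hn.le]

end Recursion

/-! ### Calculus of convergence in probability to zero -/

section InProbability

variable {Ω : Type*} [MeasurableSpace Ω] {P : Measure Ω} {f g u : ℕ → Ω → ℝ}

lemma tendstoInMeasure_zero_iff :
    TendstoInMeasure P f atTop (fun _ => 0) ↔
      ∀ ε : ℝ, 0 < ε → Tendsto (fun n => P {ω | ε ≤ |f n ω|}) atTop (𝓝 0) := by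
  simp [tendstoInMeasure_iff_norm]

/-- Markov's inequality. The majorant is extended-valued so that it can be an infinite series whose
pointwise finiteness is not known beforehand. -/
lemma tendstoInMeasure_zero_of_lintegral {M : ℕ → Ω → ℝ≥0∞} (hM : ∀ n, AEMeasurable (M n) P)
    (hle : ∀ n, ∀ᵐ ω ∂P, ‖f n ω‖ₑ ≤ M n ω)
    (hlim : Tendsto (fun n => ∫⁻ ω, M n ω ∂P) atTop (𝓝 0)) :
    TendstoInMeasure P f atTop (fun _ => 0) := by
  refine tendstoInMeasure_of_ne_top fun ε hε hεtop => ?_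
  have h1 : Tendsto (fun n => ε⁻¹ * ∫⁻ ω, M n ω ∂P) atTop (𝓝 0) := by
    simpa using ENNReal.Tendsto.const_mul hlim (Or.inr (ENNReal.inv_ne_top.2 hε.ne'))
  refine tendsto_of_tendsto_of_tendsto_of_le_of_le tendsto_const_nhds h1 (fun n => zero_le)
    fun n => ?_
  have h2 : P {ω | ε ≤ edist (f n ω) 0} ≤ P {ω | ε ≤ M n ω} := by
    refine measure_mono_ae ?_
    filter_upwards [hle n] with ω hω h
    exact (show ε ≤ edist (f n ω) 0 from h).trans (by rwa [edist_zero_right])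
  have h3 := mul_meas_ge_le_lintegral₀ (hM n) ε
  rw [mul_comm] at h3
  refine h2.trans ?_
  rw [mul_comm, ← div_eq_mul_inv]
  exact (ENNReal.le_div_iff_mul_le (Or.inl hε.ne') (Or.inl hεtop)).2 h3

/-- If `|f| ≤ |g|` whenever `|u| < c`, and `g` and `u` tend to zero in probability, so does `f`. -/
lemma MeasureTheory.TendstoInMeasure.zero_of_imp (hg : TendstoInMeasure P g atTop (fun _ => 0))
    (hu : TendstoInMeasure P u atTop (fun _ => 0)) {c : ℝ} (hc : 0 < c)
    (h : ∀ᶠ n in atTop, ∀ᵐ ω ∂P, |u n ω| < c → |f n ω| ≤ |g n ω|) :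
    TendstoInMeasure P f atTop (fun _ => 0) := by
  rw [tendstoInMeasure_zero_iff] at *
  intro ε hε
  have h1 := (hg ε hε).add (hu c hc)
  rw [add_zero] at h1
  refine tendsto_of_tendsto_of_tendsto_of_le_of_le' tendsto_const_nhds h1
    (.of_forall fun n => zero_le) (h.mono fun n hn => ?_)
  refine le_trans (measure_mono_ae ?_) (measure_union_le _ _)
  filter_upwards [hn] with ω hω hε'
  by_cases hlt : |u n ω| < c
  · exact Or.inl (le_trans (show ε ≤ |f n ω| from hε') (hω hlt))
  · exact Or.inr (not_lt.1 hlt)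

lemma MeasureTheory.TendstoInMeasure.zero_of_le (hg : TendstoInMeasure P g atTop (fun _ => 0))
    (h : ∀ᶠ n in atTop, ∀ᵐ ω ∂P, |f n ω| ≤ |g n ω|) :
    TendstoInMeasure P f atTop (fun _ => 0) :=
  hg.zero_of_imp hg zero_lt_one (h.mono fun _ hn => hn.mono fun _ hω _ => hω)

lemma MeasureTheory.TendstoInMeasure.zero_add (hf : TendstoInMeasure P f atTop (fun _ => 0))
    (hg : TendstoInMeasure P g atTop (fun _ => 0)) :
    TendstoInMeasure P (fun n ω => f n ω + g n ω) atTop (fun _ => 0) := by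
  rw [tendstoInMeasure_zero_iff] at *
  intro ε hε
  have h1 := (hf (ε / 2) (half_pos hε)).add (hg (ε / 2) (half_pos hε))
  rw [add_zero] at h1
  refine tendsto_of_tendsto_of_tendsto_of_le_of_le tendsto_const_nhds h1
    (fun n => zero_le) fun n => ?_
  refine le_trans (measure_mono fun ω hω => ?_) (measure_union_le _ _)
  by_contra hnot
  simp only [Set.mem_union, Set.mem_ofPred_eq, not_or, not_le] at hnot hω
  linarith [abs_add_le (f n ω) (g n ω)]

lemma MeasureTheory.TendstoInMeasure.zero_abs (hf : TendstoInMeasure P f atTop (fun _ => 0)) :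
    TendstoInMeasure P (fun n ω => |f n ω|) atTop (fun _ => 0) :=
  hf.zero_of_le (.of_forall fun n => .of_forall fun ω => by simp)

lemma MeasureTheory.TendstoInMeasure.zero_const_mul (hf : TendstoInMeasure P f atTop (fun _ => 0)) (c : ℝ) :
    TendstoInMeasure P (fun n ω => c * f n ω) atTop (fun _ => 0) := by
  rw [tendstoInMeasure_zero_iff] at *
  intro ε hε
  have hc : 0 < |c| + 1 := by positivity
  refine tendsto_of_tendsto_of_tendsto_of_le_of_le tendsto_const_nhds
    (hf (ε / (|c| + 1)) (by positivity)) (fun n => zero_le) fun n => measure_mono fun ω hω => ?_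
  have h1 : ε ≤ |c * f n ω| := hω
  rw [abs_mul] at h1
  show ε / (|c| + 1) ≤ |f n ω|
  rw [div_le_iff₀ hc]
  nlinarith [abs_nonneg (f n ω)]

/-- The product of a sequence tending to zero in probability and a sequence bounded in `L²` tends to
zero in probability. -/
lemma MeasureTheory.TendstoInMeasure.zero_mul_of_integral_sq_le (hf : TendstoInMeasure P f atTop (fun _ => 0))
    (hg : ∀ n, MemLp (g n) 2 P) {C : ℝ} (hC : ∀ n, ∫ ω, g n ω ^ 2 ∂P ≤ C) :
    TendstoInMeasure P (fun n ω => f n ω * g n ω) atTop (fun _ => 0) := by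
  rw [tendstoInMeasure_zero_iff] at *
  intro ε hε
  rw [ENNReal.tendsto_nhds_zero]
  intro δ hδ
  have hlimK : Tendsto (fun K : ℝ => ENNReal.ofReal (C / K ^ 2)) atTop (𝓝 0) := by
    have h1 : Tendsto (fun K : ℝ => C / K ^ 2) atTop (𝓝 0) :=
      tendsto_const_nhds.div_atTop (tendsto_pow_atTop two_ne_zero)
    simpa using ENNReal.tendsto_ofReal h1
  -- Chebyshev's inequality bounds `P(|g n| ≥ K)` by `C / K²`, uniformly in `n`; off that event `f
  -- n` only has to be smaller than `ε / K`.
  obtain ⟨K, hK, hKpos⟩ := ((ENNReal.tendsto_nhds_zero.1 hlimK (δ / 2)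
    (ENNReal.half_pos hδ.ne')).and (eventually_gt_atTop 0)).exists
  filter_upwards [ENNReal.tendsto_nhds_zero.1 (hf (ε / K) (by positivity)) (δ / 2)
    (ENNReal.half_pos hδ.ne')] with n hn
  have hgK : P {ω | K ≤ |g n ω|} ≤ δ / 2 := by
    refine le_trans ?_ hK
    have h1 := mul_meas_ge_le_integral_of_nonneg (μ := P) (f := fun ω => g n ω ^ 2)
      (.of_forall fun ω => sq_nonneg _) (hg n).integrable_sq (K ^ 2)
    have h2 : {ω | K ≤ |g n ω|} = {ω | K ^ 2 ≤ g n ω ^ 2} := by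
      ext ω
      simp only [Set.mem_ofPred_eq]
      rw [sq_le_sq, abs_of_pos hKpos]
    have hfin : P {ω | K ^ 2 ≤ g n ω ^ 2} ≠ ∞ :=
      ((hg n).integrable_sq.measure_ge_lt_top (by positivity)).ne
    rw [h2, ← ENNReal.ofReal_toReal hfin]
    refine ENNReal.ofReal_le_ofReal ?_
    rw [le_div_iff₀ (by positivity)]
    calc _ = K ^ 2 * P.real {ω | K ^ 2 ≤ g n ω ^ 2} := mul_comm _ _
      _ ≤ C := h1.trans (hC n)
  calc P {ω | ε ≤ |f n ω * g n ω|}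
      ≤ P ({ω | ε / K ≤ |f n ω|} ∪ {ω | K ≤ |g n ω|}) := by
        refine measure_mono fun ω hω => ?_
        by_contra hnot
        simp only [Set.mem_union, Set.mem_ofPred_eq, not_or, not_le] at hnot hω
        rw [abs_mul] at hω
        have := mul_lt_mul'' hnot.1 hnot.2 (abs_nonneg _) (abs_nonneg _)
        rw [div_mul_cancel₀ _ hKpos.ne'] at this
        linarith
    _ ≤ δ / 2 + δ / 2 := (measure_union_le _ _).trans (add_le_add hn hgK)
    _ = δ := ENNReal.add_halves δ

lemma tendstoInMeasure_zero_of_tendsto {a : ℕ → ℝ} (ha : Tendsto a atTop (𝓝 0)) :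
    TendstoInMeasure P (fun n _ => a n) atTop (fun _ : Ω => 0) := by
  rw [tendstoInMeasure_zero_iff]
  intro ε hε
  refine tendsto_const_nhds.congr' ?_
  filter_upwards [(Metric.tendsto_nhds.1 ha) ε hε] with n hn
  rw [Real.dist_eq, sub_zero] at hn
  simp [not_le.2 hn]

/-- Convergence to zero in `L¹` implies convergence in probability. -/
lemma tendstoInMeasure_zero_of_integral (hg : ∀ n, Integrable (g n) P)
    (hle : ∀ n, ∀ᵐ ω ∂P, |f n ω| ≤ g n ω)
    (hlim : Tendsto (fun n => ∫ ω, g n ω ∂P) atTop (𝓝 0)) :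
    TendstoInMeasure P f atTop (fun _ => 0) := by
  refine tendstoInMeasure_zero_of_lintegral (M := fun n ω => ENNReal.ofReal (g n ω))
    (fun n => (hg n).aemeasurable.ennreal_ofReal) (fun n => (hle n).mono fun ω hω => ?_) ?_
  · rw [Real.enorm_eq_ofReal_abs]
    exact ENNReal.ofReal_le_ofReal hω
  · have h1 (n : ℕ) : ∫⁻ ω, ENNReal.ofReal (g n ω) ∂P = ENNReal.ofReal (∫ ω, g n ω ∂P) :=
      (ofReal_integral_eq_lintegral_ofReal (hg n)
        ((hle n).mono fun ω hω => (abs_nonneg _).trans hω)).symm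
    simp_rw [h1]
    simpa using ENNReal.tendsto_ofReal hlim

lemma tendstoInMeasure_zero_of_sq
    (h : TendstoInMeasure P (fun n ω => f n ω ^ 2) atTop (fun _ => 0)) :
    TendstoInMeasure P f atTop (fun _ => 0) := by
  rw [tendstoInMeasure_zero_iff] at *
  intro ε hε
  refine (h (ε ^ 2) (by positivity)).congr fun n => ?_
  congr 1
  ext ω
  simp only [Set.mem_ofPred_eq, abs_pow]
  exact pow_le_pow_iff_left₀ hε.le (abs_nonneg _) two_ne_zero

end InProbability

/-! ### Sums of functions of the noise weighted by functions of the process -/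

section Sums

variable {Ω : Type*}

/-- The sum over `k < n` of `D (b (k + 1), e (k + 1)) * f (X k)`. -/
noncomputable def noiseSum (φ x₀ : ℝ) (b e : ℕ → Ω → ℝ) (D : ℝ × ℝ → ℝ) (f : ℝ → ℝ) (n : ℕ)
    (ω : Ω) : ℝ :=
  ∑ k ∈ Finset.range n, D (b (k + 1) ω, e (k + 1) ω) * f (rcaProcess φ x₀ b e k ω)

lemma measurable_noiseSum_noisePast (φ x₀ : ℝ) (b e : ℕ → Ω → ℝ) {D : ℝ × ℝ → ℝ}
    (hD : Measurable D) {f : ℝ → ℝ} (hf : Measurable f) (n : ℕ) :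
    Measurable[noisePast b e n] (noiseSum φ x₀ b e D f n) := by
  refine Finset.measurable_fun_sum _ fun k hk => ?_
  have hk : k + 1 ≤ n := Finset.mem_range.1 hk
  exact (hD.comp ((measurable_noise_noisePast b e (k + 1)).mono (noisePast_mono b e hk) le_rfl)).mul
    (hf.comp ((measurable_rca_noisePast φ x₀ b e k).mono
      (noisePast_mono b e (k.le_succ.trans hk)) le_rfl))

variable [MeasurableSpace Ω] {P : Measure Ω} {b e : ℕ → Ω → ℝ}

namespace IsIIDNoise

lemma integral_comp_noise (h : IsIIDNoise P b e) {D : ℝ × ℝ → ℝ} (hD : Measurable D) (k : ℕ) :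
    ∫ ω, D (b k ω, e k ω) ∂P = ∫ ω, D (b 0 ω, e 0 ω) ∂P :=
  ((h.ident k).comp hD).integral_eq

lemma memLp_comp_noise (h : IsIIDNoise P b e) {D : ℝ × ℝ → ℝ} (hD : Measurable D) {p : ℝ≥0∞}
    (hDp : MemLp (fun ω => D (b 0 ω, e 0 ω)) p P) (k : ℕ) :
    MemLp (fun ω => D (b k ω, e k ω)) p P :=
  ((h.ident k).comp hD).memLp_iff.2 hDp

lemma integral_noise_mul_past (h : IsIIDNoise P b e) {D : ℝ × ℝ → ℝ} (hD : Measurable D)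
    {k : ℕ} {Y : Ω → ℝ} (hY : Measurable[noisePast b e k] Y) :
    ∫ ω, D (b (k + 1) ω, e (k + 1) ω) * Y ω ∂P
      = (∫ ω, D (b 0 ω, e 0 ω) ∂P) * ∫ ω, Y ω ∂P := by
  have hYm : Measurable Y := hY.mono (h.noisePast_le k) le_rfl
  have hind := (h.indepFun_past hY).comp hD measurable_id
  have h1 := hind.integral_fun_mul_eq_mul_integral
    (hD.comp (h.measurable_pair _)).aestronglyMeasurable hYm.aestronglyMeasurable
  simp only [Function.comp_apply, id] at h1
  rw [h1, h.integral_comp_noise hD]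

lemma integrable_noise_mul_past (h : IsIIDNoise P b e) {D : ℝ × ℝ → ℝ} (hD : Measurable D)
    (hDi : Integrable (fun ω => D (b 0 ω, e 0 ω)) P)
    {k : ℕ} {Y : Ω → ℝ} (hY : Measurable[noisePast b e k] Y) (hYi : Integrable Y P) :
    Integrable (fun ω => D (b (k + 1) ω, e (k + 1) ω) * Y ω) P := by
  have hind := (h.indepFun_past hY).comp hD measurable_id
  exact hind.integrable_mul (memLp_one_iff_integrable.1
    (h.memLp_comp_noise hD (memLp_one_iff_integrable.2 hDi) (k + 1))) hYi

variable [IsProbabilityMeasure P]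

lemma integrable_comp_rca (h : IsIIDNoise P b e) (φ x₀ : ℝ) {f : ℝ → ℝ}
    (hf : Measurable f) {K : ℝ} (hK : ∀ x, |f x| ≤ K) (k : ℕ) :
    Integrable (fun ω => f (rcaProcess φ x₀ b e k ω)) P :=
  (integrable_const K).mono' (hf.comp (h.measurable_rca φ x₀ k)).aestronglyMeasurable
    (.of_forall fun _ => hK _)

/-- Each weight depends on the past of its noise term, so means factorize. Boundedness of `f` avoids
any moment condition on the process. -/
lemma integral_noiseSum (h : IsIIDNoise P b e) (φ x₀ : ℝ) {D : ℝ × ℝ → ℝ} (hD : Measurable D)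
    (hDi : Integrable (fun ω => D (b 0 ω, e 0 ω)) P) {f : ℝ → ℝ} (hf : Measurable f) {K : ℝ}
    (hK : ∀ x, |f x| ≤ K) (n : ℕ) :
    Integrable (noiseSum φ x₀ b e D f n) P ∧ ∫ ω, noiseSum φ x₀ b e D f n ω ∂P
      = (∫ ω, D (b 0 ω, e 0 ω) ∂P)
        * ∑ k ∈ Finset.range n, ∫ ω, f (rcaProcess φ x₀ b e k ω) ∂P := by
  have hYm (k : ℕ) : Measurable[noisePast b e k] fun ω => f (rcaProcess φ x₀ b e k ω) :=
    hf.comp (measurable_rca_noisePast φ x₀ b e k)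
  have hi (k : ℕ) := h.integrable_noise_mul_past hD hDi (hYm k)
    (h.integrable_comp_rca φ x₀ hf hK k)
  refine ⟨integrable_finsetSum _ fun k _ => hi k, ?_⟩
  unfold noiseSum
  rw [integral_finsetSum _ fun k _ => hi k, Finset.mul_sum]
  exact Finset.sum_congr rfl fun k _ => h.integral_noise_mul_past hD (hYm k)

/-- The summands are orthogonal when `D` is centred. -/
lemma integral_noiseSum_sq (h : IsIIDNoise P b e) (φ x₀ : ℝ) {D : ℝ × ℝ → ℝ} (hD : Measurable D)
    (hD2 : MemLp (fun ω => D (b 0 ω, e 0 ω)) 2 P) (hD0 : ∫ ω, D (b 0 ω, e 0 ω) ∂P = 0)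
    {f : ℝ → ℝ} (hf : Measurable f) {K : ℝ} (hK : ∀ x, |f x| ≤ K) (n : ℕ) :
    MemLp (noiseSum φ x₀ b e D f n) 2 P ∧ ∫ ω, noiseSum φ x₀ b e D f n ω ^ 2 ∂P
      = (∫ ω, D (b 0 ω, e 0 ω) ^ 2 ∂P)
        * ∑ k ∈ Finset.range n, ∫ ω, f (rcaProcess φ x₀ b e k ω) ^ 2 ∂P := by
  induction n with
  | zero =>
    have h0 : noiseSum φ x₀ b e D f 0 = fun _ => 0 := by ext; simp [noiseSum]
    rw [h0]
    simp
  | succ n ih =>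
    obtain ⟨ih1, ih2⟩ := ih
    have hSm := measurable_noiseSum_noisePast φ x₀ b e hD hf n
    have hXm : Measurable[noisePast b e n] fun ω => f (rcaProcess φ x₀ b e n ω) :=
      hf.comp (measurable_rca_noisePast φ x₀ b e n)
    have hX2m : Measurable[noisePast b e n] fun ω => f (rcaProcess φ x₀ b e n ω) ^ 2 :=
      hXm.pow_const 2
    have hD2m : Measurable fun p => D p ^ 2 := hD.pow_const 2
    have hK2 (x : ℝ) : |f x ^ 2| ≤ K ^ 2 := by
      rw [abs_pow]
      exact pow_le_pow_left₀ (abs_nonneg _) (hK x) 2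
    have hXi := h.integrable_comp_rca φ x₀ (hf.pow_const 2) hK2 n
    have hSX : Integrable
        (fun ω => noiseSum φ x₀ b e D f n ω * f (rcaProcess φ x₀ b e n ω)) P :=
      (ih1.integrable one_le_two).mul_bdd (c := K)
        (hf.comp (h.measurable_rca φ x₀ n)).aestronglyMeasurable (.of_forall fun ω => hK _)
    have hsq := h.integrable_noise_mul_past hD2m hD2.integrable_sq hX2m hXi
    -- The cross term: a centred noise factor times a function of the past, hence of mean zero.
    have hcr : Integrable (fun ω => D (b (n + 1) ω, e (n + 1) ω)
        * (noiseSum φ x₀ b e D f n ω * f (rcaProcess φ x₀ b e n ω))) P :=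
      h.integrable_noise_mul_past hD (hD2.integrable one_le_two) (hSm.mul hXm) hSX
    have hterm : MemLp
        (fun ω => D (b (n + 1) ω, e (n + 1) ω) * f (rcaProcess φ x₀ b e n ω)) 2 P := by
      refine (memLp_two_iff_integrable_sq (((hD.comp (h.measurable_pair (n + 1))).mul
        (hf.comp (h.measurable_rca φ x₀ n))).aestronglyMeasurable)).2 ?_
      simpa only [Pi.mul_apply, Function.comp_apply, mul_pow] using hsq
    have hsucc : noiseSum φ x₀ b e D f (n + 1) = fun ω => noiseSum φ x₀ b e D f n ω
        + D (b (n + 1) ω, e (n + 1) ω) * f (rcaProcess φ x₀ b e n ω) := by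
      ext ω
      exact Finset.sum_range_succ _ _
    refine ⟨hsucc ▸ ih1.add hterm, ?_⟩
    have hexp (ω : Ω) : noiseSum φ x₀ b e D f (n + 1) ω ^ 2
        = noiseSum φ x₀ b e D f n ω ^ 2
          + (2 * (D (b (n + 1) ω, e (n + 1) ω)
              * (noiseSum φ x₀ b e D f n ω * f (rcaProcess φ x₀ b e n ω)))
            + D (b (n + 1) ω, e (n + 1) ω) ^ 2 * f (rcaProcess φ x₀ b e n ω) ^ 2) := by
      rw [hsucc]
      ring
    simp_rw [hexp]
    rw [integral_add (g := fun ω => 2 * (D (b (n + 1) ω, e (n + 1) ω)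
              * (noiseSum φ x₀ b e D f n ω * f (rcaProcess φ x₀ b e n ω)))
            + D (b (n + 1) ω, e (n + 1) ω) ^ 2 * f (rcaProcess φ x₀ b e n ω) ^ 2)
        ih1.integrable_sq ((hcr.const_mul 2).add hsq), integral_add (hcr.const_mul 2) hsq, integral_const_mul, ih2, Finset.sum_range_succ]
    have h1 := h.integral_noise_mul_past hD (hSm.mul hXm)
    have h2 := h.integral_noise_mul_past hD2m hX2m
    simp only [Pi.mul_apply] at h1
    rw [h1, h2, hD0]
    ring

end IsIIDNoise

end Sums

/-! ### Negligible sums -/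

section Negligible

variable {Ω : Type*} [MeasurableSpace Ω] {P : Measure Ω} {b e : ℕ → Ω → ℝ}

/-- The mean of `1 / (1 + |X k|)`, averaged over `k < n`. -/
noncomputable def escapeMean (P : Measure Ω) (X : ℕ → Ω → ℝ) (n : ℕ) : ℝ :=
  (n : ℝ)⁻¹ * ∑ k ∈ Finset.range n, ∫ ω, (1 + |X k ω|)⁻¹ ∂P

lemma inv_one_add_abs_le_one (x : ℝ) : (1 + |x|)⁻¹ ≤ 1 :=
  inv_le_one_of_one_le₀ (by linarith [abs_nonneg x])

lemma abs_inv_one_add_abs_le_one (x : ℝ) : |(1 + |x|)⁻¹| ≤ 1 := by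
  rw [abs_of_nonneg (by positivity)]
  exact inv_one_add_abs_le_one x

/-- Write `x z² + y = (H z² + y) - (1 - x / H) H z²` and expand geometrically. Each term is a power
depending on `x` alone times a function of `z` alone, so a scale depending on the whole sample can
be taken out of sums over the process. -/
lemma hasSum_div_quadratic {x H y : ℝ} (hx : 0 < x) (hxH : x ≤ H) (hy : 0 < y) (c z : ℝ) :
    HasSum (fun j : ℕ => (1 - x / H) ^ j * (c * (H * z ^ 2) ^ j / (H * z ^ 2 + y) ^ (j + 1)))
      (c / (x * z ^ 2 + y)) := by
  have hH : 0 < H := hx.trans_le hxH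
  have hD : 0 < H * z ^ 2 + y := by positivity
  have hDx : 0 < x * z ^ 2 + y := by positivity
  have h1 : 0 ≤ 1 - x / H := by rw [sub_nonneg, div_le_one hH]; exact hxH
  have h2 : 1 - x / H < 1 := by have := div_pos hx hH; linarith
  have h3 : (1 - x / H) * (H * z ^ 2) / (H * z ^ 2 + y) < 1 := by
    rw [div_lt_one hD]
    nlinarith [mul_nonneg hH.le (sq_nonneg z)]
  have h4 : 0 ≤ (1 - x / H) * (H * z ^ 2) / (H * z ^ 2 + y) := by positivity
  have hs := (hasSum_geometric_of_lt_one h4 h3).mul_left (c / (H * z ^ 2 + y))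
  have h5 : c / (H * z ^ 2 + y) * (1 - (1 - x / H) * (H * z ^ 2) / (H * z ^ 2 + y))⁻¹
      = c / (x * z ^ 2 + y) := by
    have h6 : 1 - (1 - x / H) * (H * z ^ 2) / (H * z ^ 2 + y)
        = (x * z ^ 2 + y) / (H * z ^ 2 + y) := by
      field_simp
      ring
    rw [h6, inv_div]
    field_simp
  rw [h5] at hs
  have key (q u d : ℝ) (hd : d ≠ 0) (j : ℕ) :
      q ^ j * (c * u ^ j / d ^ (j + 1)) = c / d * (q * u / d) ^ j := by
    rw [div_pow, mul_pow, pow_succ]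
    field_simp
  simpa only [key _ _ _ hD.ne'] using hs

variable [IsProbabilityMeasure P]

namespace IsIIDNoise

/-- Averages of the process weights `1 / (1 + |X k|)` multiplied by integrable functions of the
noise are negligible. -/
lemma tendstoInMeasure_average (h : IsIIDNoise P b e) {φ x₀ : ℝ}
    (hesc : Tendsto (escapeMean P (rcaProcess φ x₀ b e)) atTop (𝓝 0)) {D : ℝ × ℝ → ℝ}
    (hD : Measurable D) (hDi : Integrable (fun ω => D (b 0 ω, e 0 ω)) P) (hD0 : ∀ p, 0 ≤ D p) :
    TendstoInMeasure P (fun (n : ℕ) ω =>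
      (n : ℝ)⁻¹ * noiseSum φ x₀ b e D (fun x => (1 + |x|)⁻¹) n ω) atTop (fun _ => 0) := by
  have hs := h.integral_noiseSum φ x₀ hD hDi (f := fun x => (1 + |x|)⁻¹) (by fun_prop)
    abs_inv_one_add_abs_le_one
  refine tendstoInMeasure_zero_of_integral (fun n => (hs n).1.const_mul _)
    (fun n => .of_forall fun ω => (abs_of_nonneg (mul_nonneg (by positivity)
      (Finset.sum_nonneg fun k _ => mul_nonneg (hD0 _) (by positivity)))).le) ?_
  simp_rw [integral_const_mul, (hs _).2]
  have h1 := hesc.const_mul (∫ ω, D (b 0 ω, e 0 ω) ∂P)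
  rw [mul_zero] at h1
  refine h1.congr fun n => ?_
  unfold escapeMean
  ring

/-- Orthogonality reduces the second moment to the averages of `f²`, and `(1 + |x|)⁻² ≤ (1 + |x|)⁻¹`
bounds these by the escape mean. -/
lemma integral_normalized_noiseSum_sq_le (h : IsIIDNoise P b e) (φ x₀ : ℝ) {D : ℝ × ℝ → ℝ}
    (hD : Measurable D) (hD2 : MemLp (fun ω => D (b 0 ω, e 0 ω)) 2 P)
    (hD0 : ∫ ω, D (b 0 ω, e 0 ω) ∂P = 0) {f : ℝ → ℝ} (hf : Measurable f) {K : ℝ} (hK0 : 0 ≤ K)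
    (hK : ∀ x, |f x| ≤ K * (1 + |x|)⁻¹) (n : ℕ) :
    MemLp (fun ω => (√n)⁻¹ * noiseSum φ x₀ b e D f n ω) 2 P ∧
      ∫ ω, ((√n)⁻¹ * noiseSum φ x₀ b e D f n ω) ^ 2 ∂P
        ≤ (∫ ω, D (b 0 ω, e 0 ω) ^ 2 ∂P) * K ^ 2 * escapeMean P (rcaProcess φ x₀ b e) n := by
  have hfK (x : ℝ) : |f x| ≤ K :=
    (hK x).trans (mul_le_of_le_one_right hK0 (inv_one_add_abs_le_one x))
  obtain ⟨h1, h2⟩ := h.integral_noiseSum_sq φ x₀ hD hD2 hD0 hf hfK n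
  refine ⟨h1.const_mul _, ?_⟩
  have hv : 0 ≤ ∫ ω, D (b 0 ω, e 0 ω) ^ 2 ∂P := integral_nonneg fun ω => sq_nonneg _
  have hterm (k : ℕ) : ∫ ω, f (rcaProcess φ x₀ b e k ω) ^ 2 ∂P
      ≤ K ^ 2 * ∫ ω, (1 + |(rcaProcess φ x₀ b e k ω)|)⁻¹ ∂P := by
    rw [← integral_const_mul]
    refine integral_mono
      (h.integrable_comp_rca φ x₀ (f := fun x => f x ^ 2) (hf.pow_const 2) (K := K ^ 2)
        (fun x => by rw [abs_pow]; exact pow_le_pow_left₀ (abs_nonneg _) (hfK x) 2) k)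
      ((h.integrable_comp_rca φ x₀ (f := fun x => (1 + |x|)⁻¹) (by fun_prop)
        abs_inv_one_add_abs_le_one k).const_mul _) fun ω => ?_
    have h3 := pow_le_pow_left₀ (abs_nonneg _) (hK (rcaProcess φ x₀ b e k ω)) 2
    rw [sq_abs, mul_pow] at h3
    refine h3.trans (mul_le_mul_of_nonneg_left ?_ (sq_nonneg K))
    exact pow_le_of_le_one (by positivity) (inv_one_add_abs_le_one _) two_ne_zero
  simp_rw [mul_pow, integral_const_mul, h2]
  have hsum := Finset.sum_le_sum fun k (_ : k ∈ Finset.range n) => hterm k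
  rw [← Finset.mul_sum] at hsum
  unfold escapeMean
  rw [inv_pow, Real.sq_sqrt (by positivity)]
  calc _ = (∫ ω, D (b 0 ω, e 0 ω) ^ 2 ∂P) * (n : ℝ)⁻¹
        * ∑ k ∈ Finset.range n, ∫ ω, f (rcaProcess φ x₀ b e k ω) ^ 2 ∂P := by ring
    _ ≤ (∫ ω, D (b 0 ω, e 0 ω) ^ 2 ∂P) * (n : ℝ)⁻¹
        * (K ^ 2 * ∑ k ∈ Finset.range n, ∫ ω, (1 + |(rcaProcess φ x₀ b e k ω)|)⁻¹ ∂P) :=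
      mul_le_mul_of_nonneg_left hsum (by positivity)
    _ = _ := by ring

lemma lintegral_enorm_le_sqrt_of_integral_sq_le {T : Ω → ℝ} (hT : MemLp T 2 P) {a : ℝ}
    (ha : ∫ ω, T ω ^ 2 ∂P ≤ a) : ∫⁻ ω, ‖T ω‖ₑ ∂P ≤ ENNReal.ofReal (√a) := by
  rw [← ofReal_integral_norm_eq_lintegral_enorm (hT.integrable one_le_two)]
  refine ENNReal.ofReal_le_ofReal (Real.le_sqrt_of_sq_le (le_trans ?_ ha))
  have h1 := variance_nonneg (fun ω => ‖T ω‖) P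
  rw [variance_eq_sub hT.norm] at h1
  simp only [Pi.pow_apply, Real.norm_eq_abs, sq_abs] at h1 ⊢
  linarith

/-- The sums of centred functions of the noise, weighted by `f (X k) / (x * X k ^ 2 + y)` and divided
by `√n`, are negligible uniformly in `x`. -/
lemma tendstoInMeasure_weighted (h : IsIIDNoise P b e) {φ x₀ : ℝ}
    (hesc : Tendsto (escapeMean P (rcaProcess φ x₀ b e)) atTop (𝓝 0)) {D : ℝ × ℝ → ℝ}
    (hD : Measurable D) (hD2 : MemLp (fun ω => D (b 0 ω, e 0 ω)) 2 P)
    (hD0 : ∫ ω, D (b 0 ω, e 0 ω) ∂P = 0) {f : ℝ → ℝ} (hf : Measurable f) {K L H y : ℝ}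
    (hK0 : 0 ≤ K) (hL : 0 < L) (hLH : L ≤ H) (hy : 0 < y)
    (hK : ∀ z, |f z| / (H * z ^ 2 + y) ≤ K * (1 + |z|)⁻¹) {x : ℕ → Ω → ℝ}
    (hx : ∀ n, ∀ᵐ ω ∂P, x n ω ∈ Set.Icc L H) :
    TendstoInMeasure P (fun (n : ℕ) ω => (√n)⁻¹ *
      noiseSum φ x₀ b e D (fun z => f z / (x n ω * z ^ 2 + y)) n ω) atTop (fun _ => 0) := by
  have hH : 0 < H := hL.trans_le hLH
  set ρ : ℝ := 1 - L / H with hρ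
  have hρ1 : ρ < 1 := by have := div_pos hL hH; linarith
  have hρ0 : 0 ≤ ρ := by rw [hρ, sub_nonneg, div_le_one hH]; exact hLH
  -- The expansion coefficients no longer involve the random scale, and all obey the bound for `j =
  -- 0` because `H z² ≤ H z² + y`.
  let g (j : ℕ) (z : ℝ) : ℝ := f z * (H * z ^ 2) ^ j / (H * z ^ 2 + y) ^ (j + 1)
  have hgm (j : ℕ) : Measurable (g j) := by fun_prop
  have hgK (j : ℕ) (z : ℝ) : |g j z| ≤ K * (1 + |z|)⁻¹ := by
    refine le_trans ?_ (hK z)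
    have hHz : 0 ≤ H * z ^ 2 := by positivity
    have hDp : 0 < H * z ^ 2 + y := by positivity
    simp only [g]
    rw [abs_div, abs_mul, abs_of_nonneg (pow_nonneg hHz j), abs_of_pos (pow_pos hDp (j + 1)),
      div_le_div_iff₀ (pow_pos hDp _) hDp, pow_succ (H * z ^ 2 + y) j, ← mul_assoc]
    refine mul_le_mul_of_nonneg_right (mul_le_mul_of_nonneg_left ?_ (abs_nonneg _)) hDp.le
    exact pow_le_pow_left₀ hHz (by linarith) j
  let T (n j : ℕ) (ω : Ω) : ℝ := (√n)⁻¹ * noiseSum φ x₀ b e D (g j) n ω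
  set v : ℝ := ∫ ω, D (b 0 ω, e 0 ω) ^ 2 ∂P with hv
  have hT (n j : ℕ) := h.integral_normalized_noiseSum_sq_le φ x₀ hD hD2 hD0 (hgm j) hK0 (hgK j) n
  let a (n : ℕ) : ℝ := √(v * K ^ 2 * escapeMean P (rcaProcess φ x₀ b e) n)
  -- A majorant free of `x n ω`, since `ρ` bounds `1 - x / H` on `[L, H]`. As `ρ < 1`, its mean is
  -- at most `(1 - ρ)⁻¹` times the common bound `a n` for `E|T n j|`.
  let M (n : ℕ) (ω : Ω) : ℝ≥0∞ := ∑' j : ℕ, ENNReal.ofReal ρ ^ j * ‖T n j ω‖ₑ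
  have hTm (n j : ℕ) : AEMeasurable (fun ω => ENNReal.ofReal ρ ^ j * ‖T n j ω‖ₑ) P :=
    (hT n j).1.aestronglyMeasurable.enorm.const_mul _
  refine tendstoInMeasure_zero_of_lintegral (M := M) (fun n => .tsum (hTm n))
    (fun n => ?_) ?_
  · filter_upwards [hx n] with ω hω
    have hsum : HasSum (fun j => (1 - x n ω / H) ^ j * T n j ω)
        ((√n)⁻¹ * noiseSum φ x₀ b e D (fun z => f z / (x n ω * z ^ 2 + y)) n ω) := by
      have h1 : HasSum (fun j => ∑ k ∈ Finset.range n, D (b (k + 1) ω, e (k + 1) ω)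
          * ((1 - x n ω / H) ^ j * g j (rcaProcess φ x₀ b e k ω)))
          (noiseSum φ x₀ b e D (fun z => f z / (x n ω * z ^ 2 + y)) n ω) :=
        hasSum_sum fun k _ => (hasSum_div_quadratic (hL.trans_le hω.1) hω.2 hy _ _).mul_left _
      convert! h1.mul_left (√n)⁻¹ using 2 with j
      simp only [T, noiseSum]
      rw [mul_left_comm, Finset.mul_sum]
      congr 1
      exact Finset.sum_congr rfl fun k _ => by ring
    have hr (j : ℕ) : ‖(1 - x n ω / H) ^ j * T n j ω‖ₑ ≤ ENNReal.ofReal ρ ^ j * ‖T n j ω‖ₑ := by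
      have h0 : 0 ≤ 1 - x n ω / H := by rw [sub_nonneg, div_le_one hH]; exact hω.2
      have h1 : 1 - x n ω / H ≤ ρ := by
        have := div_le_div_of_nonneg_right hω.1 hH.le
        linarith
      rw [enorm_mul, enorm_pow, Real.enorm_of_nonneg h0]
      gcongr
    rw [← hsum.tsum_eq]
    exact enorm_tsum_le_tsum_enorm.trans (ENNReal.tsum_le_tsum hr)
  · have h1 (n : ℕ) : ∫⁻ ω, M n ω ∂P ≤ (1 - ENNReal.ofReal ρ)⁻¹ * ENNReal.ofReal (a n) := by
      rw [lintegral_tsum (hTm n), ← ENNReal.tsum_geometric, ← ENNReal.tsum_mul_right]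
      refine ENNReal.tsum_le_tsum fun j => ?_
      rw [lintegral_const_mul'' _ (hT n j).1.aestronglyMeasurable.enorm]
      gcongr
      exact lintegral_enorm_le_sqrt_of_integral_sq_le (hT n j).1 (hT n j).2
    have h2 : Tendsto (fun n => (1 - ENNReal.ofReal ρ)⁻¹ * ENNReal.ofReal (a n)) atTop (𝓝 0) := by
      have h3 : Tendsto a atTop (𝓝 0) := by
        have h4 := (hesc.const_mul (v * K ^ 2)).sqrt
        rwa [mul_zero, Real.sqrt_zero] at h4
      have h5 := ENNReal.Tendsto.const_mul (a := (1 - ENNReal.ofReal ρ)⁻¹)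
        (ENNReal.tendsto_ofReal h3) (Or.inr (ENNReal.inv_ne_top.2 (by
          rw [← ENNReal.ofReal_one, ← ENNReal.ofReal_sub _ hρ0]
          simpa using hρ1)))
      simpa using h5
    exact tendsto_of_tendsto_of_tendsto_of_le_of_le tendsto_const_nhds h2 (fun n => zero_le) h1

end IsIIDNoise

end Negligible

/-! ### Deterministic properties of maximizers of the quasi-likelihood -/

section Deterministic

lemma quasiLogLik_eq_sum_range (X : ℕ → ℝ) (n : ℕ) (s x y : ℝ) :
    quasiLogLik X n s x y = ∑ k ∈ Finset.range n, -(1 / 2 : ℝ) * (Real.log (x * X k ^ 2 + y)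
      + (X (k + 1) - s * X k) ^ 2 / (x * X k ^ 2 + y)) := by
  unfold quasiLogLik
  have h1 : Finset.Icc 1 n = Finset.Ico (0 + 1) (n + 1) := by
    ext k
    simp
  rw [h1, ← Finset.sum_Ico_add', Finset.range_eq_Ico]
  rfl

variable {X : ℕ → ℝ} {n : ℕ} {y sLo sHi xLo xHi : ℝ} {z : ℝ × ℝ}

lemma IsQMLE.sum_le (h : IsQMLE X n y (Set.Icc sLo sHi ×ˢ Set.Icc xLo xHi) z) {s x : ℝ}
    (hs : s ∈ Set.Icc sLo sHi) (hx : x ∈ Set.Icc xLo xHi) :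
    ∑ k ∈ Finset.range n, (Real.log (z.2 * X k ^ 2 + y)
        + (X (k + 1) - z.1 * X k) ^ 2 / (z.2 * X k ^ 2 + y))
      ≤ ∑ k ∈ Finset.range n, (Real.log (x * X k ^ 2 + y)
        + (X (k + 1) - s * X k) ^ 2 / (x * X k ^ 2 + y)) := by
  have h1 : quasiLogLik X n s x y ≤ quasiLogLik X n z.1 z.2 y := h.2 (Set.mk_mem_prod hs hx)
  rw [quasiLogLik_eq_sum_range, quasiLogLik_eq_sum_range, ← Finset.mul_sum, ← Finset.mul_sum] at h1
  linarith

/-- The slope component of a maximizer is the weighted least squares estimator, as soon as the latter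
is admissible. -/
lemma IsQMLE.sub_eq_div (h : IsQMLE X n y (Set.Icc sLo sHi ×ˢ Set.Icc xLo xHi) z) {φ N W : ℝ}
    (hN : N = ∑ k ∈ Finset.range n, (X (k + 1) - φ * X k) * X k / (z.2 * X k ^ 2 + y))
    (hW : W = ∑ k ∈ Finset.range n, X k ^ 2 / (z.2 * X k ^ 2 + y)) (hWpos : 0 < W)
    (hmem : φ + N / W ∈ Set.Icc sLo sHi) : z.1 - φ = N / W := by
  -- With the scale fixed at `z.2`, the objective is a parabola in `s` with vertex `φ + N / W`;
  -- comparison with the vertex forces equality.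
  have hexp (s : ℝ) : ∑ k ∈ Finset.range n, (Real.log (z.2 * X k ^ 2 + y)
        + (X (k + 1) - s * X k) ^ 2 / (z.2 * X k ^ 2 + y))
      = ∑ k ∈ Finset.range n, (Real.log (z.2 * X k ^ 2 + y)
        + (X (k + 1) - φ * X k) ^ 2 / (z.2 * X k ^ 2 + y)) - 2 * (s - φ) * N + (s - φ) ^ 2 * W := by
    rw [hN, hW, Finset.mul_sum, Finset.mul_sum, ← Finset.sum_sub_distrib, ← Finset.sum_add_distrib]
    refine Finset.sum_congr rfl fun k _ => ?_
    ring
  have h1 := h.sum_le hmem h.1.2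
  rw [hexp, hexp (φ + N / W)] at h1
  have h2 : W * (z.1 - φ - N / W) ^ 2 ≤ 0 := by
    have h3 : W * (z.1 - φ - N / W) ^ 2 = (z.1 - φ) ^ 2 * W - 2 * (z.1 - φ) * N
        - ((φ + N / W - φ) ^ 2 * W - 2 * (φ + N / W - φ) * N) := by
      field_simp
      ring
    rw [h3]
    linarith
  have h4 : (z.1 - φ - N / W) ^ 2 = 0 := le_antisymm (by
    by_contra hlt
    have := mul_pos hWpos (not_le.1 hlt)
    linarith) (sq_nonneg _)
  linarith [pow_eq_zero_iff (two_ne_zero) |>.1 h4]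

/-- Expansion of the slope component of a maximizer around its leading term. -/
lemma IsQMLE.abs_sqrt_mul_sub_sub_le
    (h : IsQMLE X n y (Set.Icc sLo sHi ×ˢ Set.Icc xLo xHi) z) (hn : 0 < n) {φ β α γ δ : ℝ}
    (hz : 0 < z.2) (hδ : Set.Icc (φ - δ) (φ + δ) ⊆ Set.Icc sLo sHi)
    (hN : z.2 * ∑ k ∈ Finset.range n, (X (k + 1) - φ * X k) * X k / (z.2 * X k ^ 2 + y)
      = √n * (β + α))
    (hW : z.2 * ∑ k ∈ Finset.range n, X k ^ 2 / (z.2 * X k ^ 2 + y) = n * (1 - γ))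
    (hγ0 : 0 ≤ γ) (hγ : γ < 1 / 2) (hsmall : (√n)⁻¹ * (|β| + |α|) < δ / 2) :
    |√n * (z.1 - φ) - β| ≤ 2 * (|α| + γ * |β|) := by
  have hn' : (0 : ℝ) < n := by exact_mod_cast hn
  have hsq : 0 < √(n : ℝ) := Real.sqrt_pos.2 hn'
  have hss : √(n : ℝ) * √n = n := Real.mul_self_sqrt hn'.le
  have h1γ : 0 < 1 - γ := by linarith
  set N := ∑ k ∈ Finset.range n, (X (k + 1) - φ * X k) * X k / (z.2 * X k ^ 2 + y) with hNdef
  set W := ∑ k ∈ Finset.range n, X k ^ 2 / (z.2 * X k ^ 2 + y) with hWdef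
  have hWpos : 0 < W := by
    have : 0 < z.2 * W := by rw [hW]; positivity
    exact pos_of_mul_pos_right this hz.le
  have hNW : N / W = (√n)⁻¹ * ((β + α) / (1 - γ)) := by
    have hW' : z.2 * W = √n * √n * (1 - γ) := by rw [hW, hss]
    rw [← mul_div_mul_left N W hz.ne', hN, hW']
    field_simp
  have hab : |β + α| ≤ |β| + |α| := abs_add_le _ _
  -- Here `γ < 1/2` pays for the denominator `1 - γ`: the numerator is below `δ / 2`.
  have hNWle : |N / W| ≤ δ := by
    rw [hNW, abs_mul, abs_inv, abs_of_pos hsq, abs_div, abs_of_pos h1γ, ← mul_div_assoc,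
      div_le_iff₀ h1γ]
    have h2 : (√(n : ℝ))⁻¹ * |β + α| ≤ (√n)⁻¹ * (|β| + |α|) :=
      mul_le_mul_of_nonneg_left hab (by positivity)
    have h3 : 0 ≤ (√(n : ℝ))⁻¹ * (|β| + |α|) := by positivity
    nlinarith
  have hmem : φ + N / W ∈ Set.Icc sLo sHi := by
    have := abs_le.1 hNWle
    exact hδ ⟨by linarith, by linarith⟩
  rw [h.sub_eq_div hNdef hWdef hWpos hmem, hNW, mul_inv_cancel_left₀ hsq.ne']
  have h4 : (β + α) / (1 - γ) - β = (α + γ * β) / (1 - γ) := by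
    field_simp
    ring
  rw [h4, abs_div, abs_of_pos h1γ, div_le_iff₀ h1γ]
  have h5 : |α + γ * β| ≤ |α| + γ * |β| := by
    refine (abs_add_le _ _).trans ?_
    rw [abs_mul, abs_of_nonneg hγ0]
  have h6 : 0 ≤ |α| + γ * |β| := by positivity
  nlinarith

/-- Covers the numerators `1` and `|t|` at once; the constant comes from `1 + t² ≤ (L⁻¹ + y⁻¹)(L t²
+ y)`. -/
lemma div_quadratic_le {L x c t : ℝ} (hL : 0 < L) (hx : L ≤ x) (hy : 0 < y)
    (hc : c * (1 + |t|) ≤ 2 * (1 + t ^ 2)) :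
    c / (x * t ^ 2 + y) ≤ 2 * (L⁻¹ + y⁻¹) * (1 + |t|)⁻¹ := by
  have hD : 0 < x * t ^ 2 + y := by have := hL.trans_le hx; positivity
  have hq : 0 < 1 + |t| := by positivity
  rw [← div_eq_mul_inv, div_le_div_iff₀ hD hq]
  refine hc.trans ?_
  rw [mul_assoc]
  refine mul_le_mul_of_nonneg_left ?_ zero_le_two
  have h1 : L * t ^ 2 ≤ x * t ^ 2 := mul_le_mul_of_nonneg_right hx (sq_nonneg t)
  calc 1 + t ^ 2 ≤ (L⁻¹ + y⁻¹) * (L * t ^ 2 + y) := by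
        have h2 : (L⁻¹ + y⁻¹) * (L * t ^ 2 + y) = 1 + t ^ 2 + L * t ^ 2 / y + y / L := by
          field_simp
          ring
        rw [h2]
        have : 0 ≤ L * t ^ 2 / y := by positivity
        have : 0 ≤ y / L := by positivity
        linarith
    _ ≤ _ := mul_le_mul_of_nonneg_left (by linarith) (by positivity)

lemma one_div_quadratic_le {L x : ℝ} (hL : 0 < L) (hx : L ≤ x) (hy : 0 < y) (t : ℝ) :
    1 / (x * t ^ 2 + y) ≤ 2 * (L⁻¹ + y⁻¹) * (1 + |t|)⁻¹ :=
  div_quadratic_le hL hx hy (by nlinarith [sq_nonneg (|t| - 1), sq_abs t])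

lemma abs_div_quadratic_le {L x : ℝ} (hL : 0 < L) (hx : L ≤ x) (hy : 0 < y) (t : ℝ) :
    |t| / (x * t ^ 2 + y) ≤ 2 * (L⁻¹ + y⁻¹) * (1 + |t|)⁻¹ :=
  div_quadratic_le hL hx hy (by nlinarith [sq_nonneg (|t| - 1), sq_abs t])

/-- Apply `log u ≤ u - 1` to the combined ratio, whose excess over `1` is `y (x / v - 1) / (x t² +
y)`. The comparison of likelihoods needs only this one-sided bound. -/
lemma log_quadratic_le {L H x v : ℝ} (hL : 0 < L) (hx : x ∈ Set.Icc L H) (hv : v ∈ Set.Icc L H)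
    (hy : 0 < y) (t : ℝ) :
    Real.log (v * t ^ 2 + y) + Real.log (x / v) - Real.log (x * t ^ 2 + y)
      ≤ y * (H / L) * (2 * (L⁻¹ + y⁻¹) * (1 + |t|)⁻¹) := by
  have hxpos := hL.trans_le hx.1
  have hvpos := hL.trans_le hv.1
  have hD : 0 < x * t ^ 2 + y := by positivity
  have hD' : 0 < v * t ^ 2 + y := by positivity
  have hxv : x / v ≤ H / L := div_le_div₀ (hxpos.le.trans hx.2) hx.2 hL hv.1
  have hHL : 0 ≤ H / L := (div_pos hxpos hvpos).le.trans hxv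
  rw [← Real.log_mul hD'.ne' (by positivity), ← Real.log_div (by positivity) hD.ne']
  refine (Real.log_le_sub_one_of_pos (by positivity)).trans ?_
  have h1 : (v * t ^ 2 + y) * (x / v) / (x * t ^ 2 + y) - 1
      = y * (x / v - 1) * (1 / (x * t ^ 2 + y)) := by
    field_simp
    ring
  rw [h1]
  calc y * (x / v - 1) * (1 / (x * t ^ 2 + y)) ≤ y * (H / L) * (1 / (x * t ^ 2 + y)) := by
        refine mul_le_mul_of_nonneg_right (mul_le_mul_of_nonneg_left (by linarith) hy.le)
          (by positivity)
    _ ≤ _ := mul_le_mul_of_nonneg_left (one_div_quadratic_le hL hx.1 hy t) (by positivity)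

/-- A residual `(a t + ε)² / (x t² + y)` is close to `a² / x`. -/
lemma abs_residual_sub_le {L x : ℝ} (hL : 0 < L) (hx : L ≤ x) (hy : 0 < y) (a ε t : ℝ) :
    |(a * t + ε) ^ 2 / (x * t ^ 2 + y) - a ^ 2 / x|
      ≤ (a ^ 2 + ε ^ 2) * (y / L + 2) * (2 * (L⁻¹ + y⁻¹) * (1 + |t|)⁻¹) := by
  have hxpos := hL.trans_le hx
  have hD : 0 < x * t ^ 2 + y := by positivity
  set q := 2 * (L⁻¹ + y⁻¹) * (1 + |t|)⁻¹ with hq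
  have h1 : 1 / (x * t ^ 2 + y) ≤ q := one_div_quadratic_le hL hx hy t
  have h2 : |t| / (x * t ^ 2 + y) ≤ q := abs_div_quadratic_le hL hx hy t
  have h10 : 0 ≤ 1 / (x * t ^ 2 + y) := by positivity
  have h20 : 0 ≤ |t| / (x * t ^ 2 + y) := by positivity
  have hq0 : 0 ≤ q := h10.trans h1
  have hexp : (a * t + ε) ^ 2 / (x * t ^ 2 + y) - a ^ 2 / x
      = -(a ^ 2 * (y / x) * (1 / (x * t ^ 2 + y))) + 2 * (a * ε) * (t / (x * t ^ 2 + y))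
        + ε ^ 2 * (1 / (x * t ^ 2 + y)) := by
    field_simp
    ring
  have hyx : y / x ≤ y / L := div_le_div_of_nonneg_left hy.le hL hx
  have e1 : a ^ 2 * (y / x) * (1 / (x * t ^ 2 + y)) ≤ a ^ 2 * (y / L) * q :=
    mul_le_mul (mul_le_mul_of_nonneg_left hyx (sq_nonneg a)) h1 h10 (by positivity)
  have e2 : |2 * (a * ε) * (t / (x * t ^ 2 + y))| ≤ (a ^ 2 + ε ^ 2) * q := by
    rw [abs_mul, abs_div, abs_of_pos hD]
    refine mul_le_mul ?_ h2 h20 (by positivity)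
    rw [abs_le]
    constructor <;> nlinarith [sq_nonneg (a + ε), sq_nonneg (a - ε)]
  have e3 : ε ^ 2 * (1 / (x * t ^ 2 + y)) ≤ ε ^ 2 * q :=
    mul_le_mul_of_nonneg_left h1 (sq_nonneg ε)
  have e10 : 0 ≤ a ^ 2 * (y / x) * (1 / (x * t ^ 2 + y)) := by positivity
  have e30 : 0 ≤ ε ^ 2 * (1 / (x * t ^ 2 + y)) := by positivity
  have f1 : 0 ≤ a ^ 2 * q := by positivity
  have f2 : 0 ≤ ε ^ 2 * (y / L) * q := by positivity
  have f3 : 0 ≤ ε ^ 2 * q := by positivity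
  have f4 : 0 ≤ a ^ 2 * (y / L) * q := by positivity
  obtain ⟨g1, g2⟩ := abs_le.1 e2
  rw [hexp, abs_le]
  constructor <;> linarith

/-- With `r = w / √x` the right side is `r² - 1 - 2 log r`, and `log r ≤ r - 1`. This turns a
likelihood gap into a distance between scales. -/
lemma sq_div_sqrt_sub_one_le {w x : ℝ} (hw : 0 < w) (hx : 0 < x) :
    (w / √x - 1) ^ 2 ≤ Real.log (x / w ^ 2) + w ^ 2 / x - 1 := by
  have hsx : 0 < √x := Real.sqrt_pos.2 hx
  have h1 := Real.log_le_sub_one_of_pos (div_pos hw hsx)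
  have h2 : w ^ 2 / x = (w / √x) ^ 2 := by rw [div_pow, Real.sq_sqrt hx.le]
  have h3 : Real.log (x / w ^ 2) = -(2 * Real.log (w / √x)) := by
    rw [← inv_div, Real.log_inv, h2, Real.log_pow]
    push_cast
    ring
  rw [h3, h2]
  nlinarith

end Deterministic

/-! ### Asymptotics of the quasi-maximum likelihood estimator -/

section Asymptotics

variable {Ω : Type*}

/-- The normalized sum of the first `n` multiplicative noise terms. -/
noncomputable def normalizedSum (b : ℕ → Ω → ℝ) (n : ℕ) (ω : Ω) : ℝ :=
  (√n)⁻¹ * ∑ k ∈ Finset.range n, b (k + 1) ω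

lemma normalizedSum_eq (φ x₀ : ℝ) (b e : ℕ → Ω → ℝ) (n : ℕ) :
    normalizedSum b n = fun ω => (√n)⁻¹ * noiseSum φ x₀ b e Prod.fst (fun _ => 1) n ω := by
  ext ω
  simp [normalizedSum, noiseSum]

variable [MeasurableSpace Ω] {P : Measure Ω} [IsProbabilityMeasure P]
  {b e : ℕ → Ω → ℝ} {φ x₀ w σ : ℝ}

lemma tendsto_inv_sqrt_natCast : Tendsto (fun n : ℕ => (√(n : ℝ))⁻¹) atTop (𝓝 0) :=
  tendsto_inv_atTop_zero.comp (Real.tendsto_sqrt_atTop.comp tendsto_natCast_atTop_atTop)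

lemma inv_sqrt_natCast_le_one (n : ℕ) : (√(n : ℝ))⁻¹ ≤ 1 := by
  rcases Nat.eq_zero_or_pos n with rfl | hn
  · simp
  · exact inv_le_one_of_one_le₀ (Real.one_le_sqrt.2 (by exact_mod_cast hn))

namespace IsIIDNoise

lemma integral_normalized_noiseSum_one_sq_le (h : IsIIDNoise P b e) (φ x₀ : ℝ) {D : ℝ × ℝ → ℝ}
    (hD : Measurable D) (hD2 : MemLp (fun ω => D (b 0 ω, e 0 ω)) 2 P)
    (hD0 : ∫ ω, D (b 0 ω, e 0 ω) ∂P = 0) (n : ℕ) :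
    MemLp (fun ω => (√n)⁻¹ * noiseSum φ x₀ b e D (fun _ => 1) n ω) 2 P ∧
      ∫ ω, ((√n)⁻¹ * noiseSum φ x₀ b e D (fun _ => 1) n ω) ^ 2 ∂P
        ≤ ∫ ω, D (b 0 ω, e 0 ω) ^ 2 ∂P := by
  obtain ⟨h1, h2⟩ := h.integral_noiseSum_sq φ x₀ hD hD2 hD0 (f := fun _ => 1) measurable_const
    (K := 1) (by simp) n
  refine ⟨h1.const_mul _, ?_⟩
  have hv : 0 ≤ ∫ ω, D (b 0 ω, e 0 ω) ^ 2 ∂P := integral_nonneg fun ω => sq_nonneg _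
  simp_rw [mul_pow, integral_const_mul, h2]
  rw [inv_pow, Real.sq_sqrt (by positivity)]
  rcases Nat.eq_zero_or_pos n with rfl | hn
  · simpa using hv
  · have : (n : ℝ) ≠ 0 := by positivity
    simp only [one_pow, integral_const, probReal_univ, smul_eq_mul, mul_one, Finset.sum_const,
      Finset.card_range, nsmul_eq_mul]
    field_simp
    exact le_rfl

/-- Averages of centred functions of the noise are negligible. -/
lemma tendstoInMeasure_noise_average (h : IsIIDNoise P b e) (φ x₀ : ℝ) {D : ℝ × ℝ → ℝ}
    (hD : Measurable D) (hD2 : MemLp (fun ω => D (b 0 ω, e 0 ω)) 2 P)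
    (hD0 : ∫ ω, D (b 0 ω, e 0 ω) ∂P = 0) :
    TendstoInMeasure P
      (fun (n : ℕ) ω => (n : ℝ)⁻¹ * noiseSum φ x₀ b e D (fun _ => 1) n ω) atTop (fun _ => 0) := by
  have h1 := h.integral_normalized_noiseSum_one_sq_le φ x₀ hD hD2 hD0
  refine ((tendstoInMeasure_zero_of_tendsto tendsto_inv_sqrt_natCast).zero_mul_of_integral_sq_le
    (fun n => (h1 n).1) fun n => (h1 n).2).zero_of_le (.of_forall fun n => .of_forall fun ω => ?_)
  rw [← mul_assoc, ← mul_inv, Real.mul_self_sqrt (by positivity)]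

/-- The slope component of the quasi-maximum likelihood estimator is asymptotically equivalent to
the mean of the multiplicative noise. -/
theorem tendstoInMeasure_slope_sub (h : IsIIDNoise P b e)
    (hm : NoiseMoments P (b 0) (e 0) w σ)
    (hesc : Tendsto (escapeMean P (rcaProcess φ x₀ b e)) atTop (𝓝 0))
    {sLo sHi xLo xHi y : ℝ} (hxLo : 0 < xLo) (hx : xLo ≤ xHi) (hφ : φ ∈ Set.Ioo sLo sHi)
    (hy : 0 < y) {η : ℕ → Ω → ℝ × ℝ}
    (hη : ∀ n, ∀ᵐ ω ∂P, IsQMLE (fun k => rcaProcess φ x₀ b e k ω) n y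
      (Set.Icc sLo sHi ×ˢ Set.Icc xLo xHi) (η n ω)) :
    TendstoInMeasure P (fun (n : ℕ) ω => √n * ((η n ω).1 - φ) - normalizedSum b n ω) atTop
      (fun _ => 0) := by
  have hxHi : 0 < xHi := hxLo.trans_le hx
  have hmem (n : ℕ) : ∀ᵐ ω ∂P, (η n ω).2 ∈ Set.Icc xLo xHi := (hη n).mono fun ω hω => hω.1.2
  set κ : ℝ := 2 * (xLo⁻¹ + y⁻¹) with hκ
  have hκ0 : 0 ≤ κ := by positivity
  let α₁ (n : ℕ) (ω : Ω) : ℝ := (√n)⁻¹ *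
    noiseSum φ x₀ b e Prod.fst (fun z => (fun _ => 1) z / ((η n ω).2 * z ^ 2 + y)) n ω
  let α₂ (n : ℕ) (ω : Ω) : ℝ := (√n)⁻¹ *
    noiseSum φ x₀ b e Prod.snd (fun z => z / ((η n ω).2 * z ^ 2 + y)) n ω
  have hα₁ : TendstoInMeasure P α₁ atTop (fun _ => 0) :=
    h.tendstoInMeasure_weighted hesc _root_.measurable_fst hm.memLp_fst hm.mean_fst measurable_const hκ0
      hxLo hx hy (fun z => by simpa using one_div_quadratic_le hxLo hx hy z) hmem
  have hα₂ : TendstoInMeasure P α₂ atTop (fun _ => 0) :=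
    h.tendstoInMeasure_weighted hesc _root_.measurable_snd hm.memLp_snd hm.mean_snd measurable_id hκ0
      hxLo hx hy (fun z => abs_div_quadratic_le hxLo hx hy z) hmem
  -- From `x (b X + e) X / (x X² + y) = b - y b / (x X² + y) + x e X / (x X² + y)`: the numerator of
  -- the least squares quotient is the normalized noise sum plus `α`.
  let α (n : ℕ) (ω : Ω) : ℝ := -y * α₁ n ω + (η n ω).2 * α₂ n ω
  have hα : TendstoInMeasure P α atTop (fun _ => 0) := by
    refine (hα₁.zero_const_mul (-y)).zero_add ((hα₂.zero_const_mul xHi).zero_of_le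
      (.of_forall fun n => (hmem n).mono fun ω hω => ?_))
    rw [abs_mul _ (α₂ n ω), abs_mul xHi, abs_of_pos (hxLo.trans_le hω.1), abs_of_pos hxHi]
    exact mul_le_mul_of_nonneg_right hω.2 (abs_nonneg _)
  -- The defect of the denominator, from `1 - x X² / (x X² + y) = y / (x X² + y)`.
  let γ (n : ℕ) (ω : Ω) : ℝ := (n : ℝ)⁻¹ * ∑ k ∈ Finset.range n,
    y / ((η n ω).2 * rcaProcess φ x₀ b e k ω ^ 2 + y)
  have hγ0 (n : ℕ) : ∀ᵐ ω ∂P, 0 ≤ γ n ω := (hmem n).mono fun ω hω => by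
    have := hxLo.trans_le hω.1
    exact mul_nonneg (by positivity) (Finset.sum_nonneg fun k _ => by positivity)
  have hγ : TendstoInMeasure P γ atTop (fun _ => 0) := by
    refine (h.tendstoInMeasure_average hesc (D := fun _ => y * κ) measurable_const
      (integrable_const _) (fun _ => by positivity)).zero_of_le
      (.of_forall fun n => ?_)
    filter_upwards [hmem n, hγ0 n] with ω hω h0
    rw [abs_of_nonneg h0]
    refine le_trans (mul_le_mul_of_nonneg_left (Finset.sum_le_sum fun k _ => ?_) (by positivity))
      (le_abs_self _)
    rw [mul_assoc, ← mul_one_div]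
    exact mul_le_mul_of_nonneg_left (one_div_quadratic_le hxLo hω.1 hy _) hy.le
  have hβ (n : ℕ) : MemLp (normalizedSum b n) 2 P ∧ ∫ ω, normalizedSum b n ω ^ 2 ∂P ≤ w ^ 2 := by
    have h1 := h.integral_normalized_noiseSum_one_sq_le φ x₀ _root_.measurable_fst hm.memLp_fst
      hm.mean_fst n
    rw [normalizedSum_eq φ x₀ b e, ← hm.var_fst]
    exact h1
  have hγβ : TendstoInMeasure P (fun n ω => γ n ω * normalizedSum b n ω) atTop (fun _ => 0) :=
    hγ.zero_mul_of_integral_sq_le (fun n => (hβ n).1) fun n => (hβ n).2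
  have hβs : TendstoInMeasure P (fun (n : ℕ) ω => (√n)⁻¹ * normalizedSum b n ω) atTop (fun _ => 0) :=
    (tendstoInMeasure_zero_of_tendsto tendsto_inv_sqrt_natCast).zero_mul_of_integral_sq_le
      (fun n => (hβ n).1) fun n => (hβ n).2
  have hαs : TendstoInMeasure P (fun (n : ℕ) ω => (√n)⁻¹ * α n ω) atTop (fun _ => 0) :=
    hα.zero_of_le (.of_forall fun n => .of_forall fun ω => by
      rw [abs_mul, abs_of_nonneg (a := (√(n : ℝ))⁻¹) (by positivity)]
      exact mul_le_of_le_one_left (abs_nonneg _) (inv_sqrt_natCast_le_one n))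
  set δ : ℝ := min (φ - sLo) (sHi - φ) with hδ
  have hδ0 : 0 < δ := lt_min (sub_pos.2 hφ.1) (sub_pos.2 hφ.2)
  have hδsub : Set.Icc (φ - δ) (φ + δ) ⊆ Set.Icc sLo sHi := fun s hs => by
    have h1 := min_le_left (φ - sLo) (sHi - φ)
    have h2 := min_le_right (φ - sLo) (sHi - φ)
    exact ⟨by linarith [hs.1], by linarith [hs.2]⟩
  refine ((hα.zero_abs.zero_add hγβ.zero_abs).zero_const_mul 2).zero_of_imp
    (hγ.zero_abs.zero_add (hβs.zero_abs.zero_add hαs.zero_abs))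
    (c := min (1 / 2) (δ / 2)) (by positivity) ?_
  filter_upwards [eventually_gt_atTop 0] with n hn
  filter_upwards [hη n, hmem n, hγ0 n] with ω hω hxω hγω hsmall
  have hxpos : 0 < (η n ω).2 := hxLo.trans_le hxω.1
  have hn' : (0 : ℝ) < n := by exact_mod_cast hn
  have hsq : 0 < √(n : ℝ) := Real.sqrt_pos.2 hn'
  have hD (k : ℕ) : (η n ω).2 * rcaProcess φ x₀ b e k ω ^ 2 + y ≠ 0 := by positivity
  rw [abs_of_nonneg (by positivity), lt_min_iff] at hsmall
  simp only [abs_mul, abs_inv, abs_of_pos hsq, abs_of_nonneg hγω] at hsmall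
  have p1 : 0 ≤ (√(n : ℝ))⁻¹ * |normalizedSum b n ω| := by positivity
  have p2 : 0 ≤ (√(n : ℝ))⁻¹ * |α n ω| := by positivity
  have key := hω.abs_sqrt_mul_sub_sub_le hn (φ := φ) (β := normalizedSum b n ω) (α := α n ω)
    (γ := γ n ω) (δ := δ) hxpos hδsub ?_ ?_ hγω (by linarith [hsmall.1])
    (by rw [mul_add]; linarith [hsmall.2])
  · rw [abs_of_nonneg (a := 2 * (|α n ω| + |γ n ω * normalizedSum b n ω|)) (by positivity), abs_mul,
      abs_of_nonneg hγω]
    exact key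
  · simp only [α, α₁, α₂, normalizedSum, noiseSum]
    rw [mul_add, mul_add, mul_inv_cancel_left₀ hsq.ne', ← mul_assoc (√(n : ℝ)) (-y),
      mul_comm (√(n : ℝ)) (-y), mul_assoc (-y), mul_inv_cancel_left₀ hsq.ne',
      mul_left_comm (√(n : ℝ)) (η n ω).2, mul_inv_cancel_left₀ hsq.ne', Finset.mul_sum,
      Finset.mul_sum, Finset.mul_sum, ← Finset.sum_add_distrib, ← Finset.sum_add_distrib]
    refine Finset.sum_congr rfl fun k _ => ?_
    have hDk := hD k
    rw [rcaProcess]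
    field_simp
    ring
  · simp only [γ]
    rw [mul_sub, mul_one, mul_inv_cancel_left₀ hn'.ne', Finset.mul_sum]
    have h1 : (n : ℝ) = ∑ k ∈ Finset.range n, (1 : ℝ) := by simp
    conv_rhs => rw [h1]
    rw [← Finset.sum_sub_distrib]
    refine Finset.sum_congr rfl fun k _ => ?_
    have hDk := hD k
    field_simp
    ring

end IsIIDNoise

end Asymptotics

/-! ### Consistency of the scale component -/

section Consistency

/-- The maximality of the scale component of a maximizer, expressed through the noise. -/
lemma IsQMLE.log_div_add_le {X a ε : ℕ → ℝ} {n : ℕ} {y sLo sHi xLo xHi v : ℝ} {z : ℝ × ℝ}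
    (h : IsQMLE X n y (Set.Icc sLo sHi ×ˢ Set.Icc xLo xHi) z) (hn : 0 < n) (hxLo : 0 < xLo)
    (hy : 0 < y) (hv : v ∈ Set.Icc xLo xHi) (hX : ∀ k, X (k + 1) - z.1 * X k = a k * X k + ε k) :
    Real.log (z.2 / v) + (z.2⁻¹ - v⁻¹) * ((n : ℝ)⁻¹ * ∑ k ∈ Finset.range n, a k ^ 2)
      ≤ (y * (xHi / xLo) + 2 * (y / xLo + 2)) * (2 * (xLo⁻¹ + y⁻¹)) *
        ((n : ℝ)⁻¹ * ∑ k ∈ Finset.range n, (1 + a k ^ 2 + ε k ^ 2) * (1 + |X k|)⁻¹) := by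
  have hn' : (0 : ℝ) < n := by exact_mod_cast hn
  have hx := h.1.2
  have hHL : 0 ≤ xHi / xLo := div_nonneg (hxLo.le.trans (hv.1.trans hv.2)) hxLo.le
  set κ : ℝ := 2 * (xLo⁻¹ + y⁻¹) with hκ
  have hκ0 : 0 ≤ κ := by positivity
  -- The competitor keeps the slope `z.1`, so both residuals involve the same `a k` and `ε k`; each
  -- quotient is replaced by its limit for large `|X k|`, at a cost proportional to `(1 + |X k|)⁻¹`.
  have hterm (k : ℕ) :
      Real.log (v * X k ^ 2 + y) + (X (k + 1) - z.1 * X k) ^ 2 / (v * X k ^ 2 + y)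
        ≤ Real.log (z.2 * X k ^ 2 + y) + (X (k + 1) - z.1 * X k) ^ 2 / (z.2 * X k ^ 2 + y)
          - Real.log (z.2 / v) - (z.2⁻¹ - v⁻¹) * a k ^ 2
          + (y * (xHi / xLo) + 2 * (y / xLo + 2)) * κ
            * ((1 + a k ^ 2 + ε k ^ 2) * (1 + |X k|)⁻¹) := by
    rw [hX]
    have h1 := log_quadratic_le hxLo hx hv hy (X k)
    have h2 := abs_le.1 (abs_residual_sub_le hxLo hx.1 hy (a k) (ε k) (X k))
    have h3 := abs_le.1 (abs_residual_sub_le hxLo hv.1 hy (a k) (ε k) (X k))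
    rw [← hκ] at h1 h2 h3
    set q := (1 + |X k|)⁻¹ with hq
    have hq0 : 0 ≤ q := by positivity
    have h4 : 0 ≤ (y * (xHi / xLo)) * κ * (a k ^ 2 + ε k ^ 2) * q := by positivity
    have h5 : 0 ≤ (2 * (y / xLo + 2)) * κ * q := by positivity
    rw [div_eq_mul_inv (a k ^ 2)] at h2 h3
    linarith [h2.1, h3.2]
  have h6 := (h.sum_le h.1.1 hv).trans (Finset.sum_le_sum fun k _ => hterm k)
  simp only [Finset.sum_add_distrib, Finset.sum_sub_distrib, ← Finset.mul_sum,
    Finset.sum_const, Finset.card_range, nsmul_eq_mul] at h6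
  rw [← mul_le_mul_iff_right₀ hn', mul_add, mul_left_comm, mul_inv_cancel_left₀ hn'.ne',
    mul_left_comm (n : ℝ) _ (_ * Finset.sum _ _), mul_inv_cancel_left₀ hn'.ne']
  linarith

variable {Ω : Type*} [MeasurableSpace Ω] {P : Measure Ω} [IsProbabilityMeasure P]
  {b e : ℕ → Ω → ℝ} {φ x₀ w σ : ℝ}

/-- The scale component of the quasi-maximum likelihood estimator is consistent. -/
theorem IsIIDNoise.tendstoInMeasure_scale (h : IsIIDNoise P b e)
    (hm : NoiseMoments P (b 0) (e 0) w σ) (hb4 : Integrable (fun ω => b 0 ω ^ 4) P)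
    (hw : 0 < w) (hesc : Tendsto (escapeMean P (rcaProcess φ x₀ b e)) atTop (𝓝 0))
    {sLo sHi xLo xHi y : ℝ} (hxLo : 0 < xLo) (hφ : φ ∈ Set.Ioo sLo sHi)
    (hwmem : w ^ 2 ∈ Set.Icc xLo xHi) (hy : 0 < y) {η : ℕ → Ω → ℝ × ℝ}
    (hη : ∀ n, ∀ᵐ ω ∂P, IsQMLE (fun k => rcaProcess φ x₀ b e k ω) n y
      (Set.Icc sLo sHi ×ˢ Set.Icc xLo xHi) (η n ω)) :
    TendstoInMeasure P (fun n ω => w / √(η n ω).2 - 1) atTop (fun _ => 0) := by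
  have hslope := h.tendstoInMeasure_slope_sub hm hesc hxLo (hwmem.1.trans hwmem.2) hφ hy hη
  set X := rcaProcess φ x₀ b e with hXdef
  have hQ := h.tendstoInMeasure_average hesc (D := fun p => 1 + p.1 ^ 2 + p.2 ^ 2) (by fun_prop)
    (((integrable_const 1).add hm.memLp_fst.integrable_sq).add hm.memLp_snd.integrable_sq)
    (fun p => by positivity)
  have hsqm : Measurable fun p : ℝ × ℝ => p.1 ^ 2 - w ^ 2 := by fun_prop
  -- The fourth moment of `b 0` makes `b² - w²` square integrable, so the average of `b²` converges
  -- by orthogonality.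
  have hτ := h.tendstoInMeasure_noise_average φ x₀ hsqm (by
      refine MemLp.sub ?_ (memLp_const (w ^ 2))
      rw [memLp_two_iff_integrable_sq ((h.measurable_fst 0).pow_const 2).aestronglyMeasurable]
      simpa only [← pow_mul] using hb4) (by
      rw [integral_sub hm.memLp_fst.integrable_sq (integrable_const _), hm.var_fst]
      simp)
  have hb := h.tendstoInMeasure_noise_average φ x₀ _root_.measurable_fst hm.memLp_fst hm.mean_fst
  set S : ℝ := sHi - sLo with hS
  have hS0 : 0 ≤ S := sub_nonneg.2 (hφ.1.trans hφ.2).le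
  -- Consistency of the slope: divide its expansion by `√n`.
  have hc : TendstoInMeasure P (fun n ω => φ - (η n ω).1) atTop (fun _ => 0) := by
    refine (hslope.zero_abs.zero_add hb.zero_abs).zero_of_le ?_
    filter_upwards [eventually_gt_atTop 0] with n hn
    refine .of_forall fun ω => ?_
    have hn' : (0 : ℝ) < n := by exact_mod_cast hn
    have hsq : 0 < √(n : ℝ) := Real.sqrt_pos.2 hn'
    rw [abs_of_nonneg (a := |_| + |_|) (by positivity)]
    have h1 : φ - (η n ω).1 = -((√n)⁻¹ * (√n * ((η n ω).1 - φ) - normalizedSum b n ω))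
        - (n : ℝ)⁻¹ * noiseSum φ x₀ b e Prod.fst (fun _ => 1) n ω := by
      have h2 : (n : ℝ)⁻¹ = (√n)⁻¹ * (√n)⁻¹ := by
        rw [← mul_inv, Real.mul_self_sqrt hn'.le]
      rw [normalizedSum_eq φ x₀ b e, h2, mul_sub, inv_mul_cancel_left₀ hsq.ne']
      ring
    rw [h1]
    refine (abs_sub _ _).trans (add_le_add_left ?_ _)
    rw [abs_neg, abs_mul, abs_of_pos (inv_pos.2 hsq)]
    exact mul_le_of_le_one_left (abs_nonneg _) (inv_sqrt_natCast_le_one n)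
  set K : ℝ := (y * (xHi / xLo) + 2 * (y / xLo + 2)) * (2 * (xLo⁻¹ + y⁻¹)) with hK
  have hHL : 0 ≤ xHi / xLo := div_nonneg (hxLo.le.trans (hwmem.1.trans hwmem.2)) hxLo.le
  have hK0 : 0 ≤ K := by positivity
  refine tendstoInMeasure_zero_of_sq (((hQ.zero_const_mul (K * (2 + 2 * S ^ 2))).zero_add
    ((((hc.zero_abs.zero_const_mul S).zero_add (hb.zero_abs.zero_const_mul (2 * S))).zero_add
      hτ.zero_abs).zero_const_mul xLo⁻¹)).zero_of_le ?_)
  filter_upwards [eventually_gt_atTop 0] with n hn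
  filter_upwards [hη n] with ω hω
  have hn' : (0 : ℝ) < n := by exact_mod_cast hn
  have hxmem := hω.1.2
  have hsmem := hω.1.1
  have hxpos : 0 < (η n ω).2 := hxLo.trans_le hxmem.1
  set c : ℝ := φ - (η n ω).1 with hcdef
  have hcS : |c| ≤ S := by
    rw [abs_le]
    constructor <;> linarith [hφ.1, hφ.2, hsmem.1, hsmem.2]
  -- At the estimated slope the multiplicative residual is `b` shifted by the slope error `c`; since
  -- `|c| ≤ S`, this shift costs only the constant `2 + 2 S²` in the remainder.
  have key := hω.log_div_add_le (a := fun k => c + b (k + 1) ω) (ε := fun k => e (k + 1) ω)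
    hn hxLo hy hwmem (fun k => by simp only [hXdef, rcaProcess, hcdef]; ring)
  set b' := (n : ℝ)⁻¹ * noiseSum φ x₀ b e Prod.fst (fun _ => 1) n ω with hb'
  set τ := (n : ℝ)⁻¹ * noiseSum φ x₀ b e (fun p => p.1 ^ 2 - w ^ 2) (fun _ => 1) n ω with hτ'
  set Q := (n : ℝ)⁻¹ * noiseSum φ x₀ b e (fun p => 1 + p.1 ^ 2 + p.2 ^ 2)
    (fun x => (1 + |x|)⁻¹) n ω with hQ'
  have hmean : (n : ℝ)⁻¹ * ∑ k ∈ Finset.range n, (c + b (k + 1) ω) ^ 2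
      = w ^ 2 + (c ^ 2 + 2 * c * b' + τ) := by
    have h1 : ∑ k ∈ Finset.range n, (c + b (k + 1) ω) ^ 2
        = n * (w ^ 2 + c ^ 2) + 2 * c * noiseSum φ x₀ b e Prod.fst (fun _ => 1) n ω
          + noiseSum φ x₀ b e (fun p => p.1 ^ 2 - w ^ 2) (fun _ => 1) n ω := by
      simp only [noiseSum, mul_one]
      rw [Finset.mul_sum, ← Finset.card_range n, ← nsmul_eq_mul, ← Finset.sum_const,
        Finset.card_range, ← Finset.sum_add_distrib, ← Finset.sum_add_distrib]
      exact Finset.sum_congr rfl fun k _ => by ring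
    rw [h1, hb', hτ']
    field_simp
    ring
  have hQle : (n : ℝ)⁻¹ * ∑ k ∈ Finset.range n,
      (1 + (c + b (k + 1) ω) ^ 2 + e (k + 1) ω ^ 2) * (1 + |X k ω|)⁻¹
        ≤ (2 + 2 * S ^ 2) * Q := by
    rw [hQ', mul_left_comm]
    refine mul_le_mul_of_nonneg_left ?_ (by positivity)
    rw [noiseSum, Finset.mul_sum]
    refine Finset.sum_le_sum fun k _ => ?_
    rw [← mul_assoc]
    refine mul_le_mul_of_nonneg_right ?_ (by positivity)
    have h1 : c ^ 2 ≤ S ^ 2 := sq_le_sq.2 (by rwa [abs_of_nonneg hS0])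
    have h2 : 0 ≤ S ^ 2 * b (k + 1) ω ^ 2 := by positivity
    have h3 : 0 ≤ S ^ 2 * e (k + 1) ω ^ 2 := by positivity
    nlinarith [sq_nonneg (c - b (k + 1) ω), sq_nonneg (e (k + 1) ω)]
  have hQ0 : 0 ≤ Q := mul_nonneg (by positivity)
    (Finset.sum_nonneg fun k _ => mul_nonneg (by positivity) (by positivity))
  rw [hmean] at key
  have hθ : |c ^ 2 + 2 * c * b' + τ| ≤ S * |c| + 2 * S * |b'| + |τ| := by
    refine (abs_add_le _ _).trans (add_le_add_left ((abs_add_le _ _).trans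
      (add_le_add ?_ ?_)) _)
    · rw [abs_pow, sq]
      exact mul_le_mul_of_nonneg_right hcS (abs_nonneg _)
    · rw [abs_mul, abs_mul, abs_two]
      exact mul_le_mul_of_nonneg_right (by linarith) (abs_nonneg _)
  have hinv : |(η n ω).2⁻¹ - (w ^ 2)⁻¹| ≤ xLo⁻¹ := by
    have h1 := inv_anti₀ hxLo hxmem.1
    have h2 := inv_anti₀ hxLo hwmem.1
    have h3 := inv_pos.2 hxpos
    have h4 : 0 < (w ^ 2)⁻¹ := by positivity
    rw [abs_le]
    constructor <;> linarith
  have hprod : -((η n ω).2⁻¹ - (w ^ 2)⁻¹) * (c ^ 2 + 2 * c * b' + τ)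
      ≤ xLo⁻¹ * (S * |c| + 2 * S * |b'| + |τ|) := by
    refine (le_abs_self _).trans ?_
    rw [abs_mul, abs_neg]
    exact mul_le_mul hinv hθ (abs_nonneg _) (by positivity)
  have hsq := sq_div_sqrt_sub_one_le hw hxpos
  have hw2 : ((η n ω).2⁻¹ - (w ^ 2)⁻¹) * w ^ 2 = w ^ 2 / (η n ω).2 - 1 := by
    field_simp
  have hKQ := mul_le_mul_of_nonneg_left hQle hK0
  rw [abs_of_nonneg (sq_nonneg _)]
  refine le_trans ?_ (le_abs_self _)
  linarith

end Consistency

/-! ### Central limit theorem for the multiplicative noise -/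

section CentralLimit

variable {Ω : Type*} [MeasurableSpace Ω] {P : Measure Ω} [IsProbabilityMeasure P]
  {b e : ℕ → Ω → ℝ} {w σ : ℝ}

/-- The central limit theorem for the noise. -/
theorem IsIIDNoise.tendstoInDistribution_normalizedSum (h : IsIIDNoise P b e)
    (hm : NoiseMoments P (b 0) (e 0) w σ) (hw : 0 < w) :
    TendstoInDistribution (fun n ω => normalizedSum b n ω / w) atTop (id : ℝ → ℝ)
      (fun _ => P) (gaussianReal 0 1) := by
  have hident (k : ℕ) : IdentDistrib (b k) (b 0) P P := (h.ident k).comp _root_.measurable_fst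
  have hind : iIndepFun (fun k => b (k + 1)) P :=
    (h.indep.comp (fun _ => Prod.fst) (fun _ => _root_.measurable_fst)).precomp
      (add_left_injective 1)
  have hdiv : Measurable fun x : ℝ => x / w := by fun_prop
  have hmean : ∫ ω, b 1 ω ∂P = 0 := (hident 1).integral_eq.trans hm.mean_fst
  have hvar : ∫ ω, b 1 ω ^ 2 ∂P = w ^ 2 :=
    ((hident 1).comp (u := fun x => x ^ 2) (by fun_prop)).integral_eq.trans hm.var_fst
  have key := tendstoInDistribution_inv_sqrt_mul_sum (P := P) (P' := gaussianReal 0 1)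
    (X := fun k ω => b (k + 1) ω / w) (Y := id) (HasLaw.id)
    (by simp [integral_div, hmean])
    (by
      simp only [Pi.pow_apply, div_pow, zero_add, integral_div, hvar]
      exact div_self (pow_pos hw 2).ne')
    (hind.comp (fun _ x => x / w) fun _ => hdiv)
    (fun i => ((hident (i + 1)).trans (hident 1).symm).comp hdiv)
  convert key using 3 with n
  simp [normalizedSum, Finset.sum_div, mul_div_assoc]

end CentralLimit

/-! ### Conclusion by Slutsky's theorem -/

theorem theorem2p3 {Ω : Type*} [MeasurableSpace Ω] (P : Measure Ω) [IsProbabilityMeasure P]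
    -- the innovations: i.i.d. random vectors `(b k, e k)`
    (b e : ℕ → Ω → ℝ)
    (hb_meas : ∀ k, Measurable (b k)) (he_meas : ∀ k, Measurable (e k))
    (h_indep : iIndepFun (fun k ω => (b k ω, e k ω)) P)
    (h_ident : ∀ k, IdentDistrib (fun ω => (b k ω, e k ω)) (fun ω => (b 0 ω, e 0 ω)) P P)
    -- the parameters and the moment conditions; `w` is the standard deviation of `b 0`
    (φ w σ : ℝ) (hw : 0 < w) (hσ : 0 < σ)
    (hb4 : Integrable (fun ω => b 0 ω ^ 4) P) (he4 : Integrable (fun ω => e 0 ω ^ 4) P)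
    (hb_mean : ∫ ω, b 0 ω ∂P = 0) (hb_var : ∫ ω, b 0 ω ^ 2 ∂P = w ^ 2)
    (he_mean : ∫ ω, e 0 ω ∂P = 0) (he_var : ∫ ω, e 0 ω ^ 2 ∂P = σ ^ 2)
    (h_cov : cov[b 0, e 0; P] = 0)
    -- nonstationarity
    (h_log : LogMeanNonneg (fun ω => φ + b 0 ω) P)
    -- the constant initial value and the parameter rectangle
    (x₀ : ℝ) (sLo sHi xLo xHi : ℝ) (hs : sLo < sHi) (hxLo : 0 < xLo) (hx : xLo < xHi)
    (hφ : φ ∈ Set.Ioo sLo sHi) (hw_mem : w ^ 2 ∈ Set.Icc xLo xHi)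
    -- the quasi-maximum likelihood estimators for a fixed `y > 0`
    (y : ℝ) (hy : 0 < y) (η : ℕ → Ω → ℝ × ℝ) (hη_meas : ∀ n, AEMeasurable (η n) P)
    (hη : ∀ n, ∀ᵐ ω ∂P, IsQMLE (fun k => rcaProcess φ x₀ b e k ω) n y
      (Set.Icc sLo sHi ×ˢ Set.Icc xLo xHi) (η n ω)) :
    TendstoInDistribution
        (fun (n : ℕ) ω => Real.sqrt n * ((η n ω).1 - φ) / w)
        atTop (id : ℝ → ℝ) (fun _ => P) (gaussianReal 0 1) ∧
      TendstoInDistribution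
        (fun (n : ℕ) ω => Real.sqrt n * ((η n ω).1 - φ) / Real.sqrt (η n ω).2)
        atTop (id : ℝ → ℝ) (fun _ => P) (gaussianReal 0 1) := by
  have h : IsIIDNoise P b e := ⟨hb_meas, he_meas, h_indep, h_ident⟩
  have hb2 := memLp_two_of_integrable_pow_four (hb_meas 0) hb4
  have he2 := memLp_two_of_integrable_pow_four (he_meas 0) he4
  have hm : NoiseMoments P (b 0) (e 0) w σ :=
    { memLp_fst := hb2
      memLp_snd := he2
      mean_fst := hb_mean
      mean_snd := he_mean
      var_fst := hb_var
      var_snd := he_var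
      cov := by simpa [covariance_eq_sub hb2 he2, hb_mean, he_mean] using h_cov }
  have hesc : Tendsto (escapeMean P (rcaProcess φ x₀ b e)) atTop (𝓝 0) :=
    h.tendsto_average_inv_one_add_abs hm hw hσ h_log x₀
  have hslope := h.tendstoInMeasure_slope_sub hm hesc hxLo hx.le hφ hy hη
  have hscale := h.tendstoInMeasure_scale hm hb4 hw hesc hxLo hφ hw_mem hy hη
  have h1 : TendstoInDistribution (fun (n : ℕ) ω => Real.sqrt n * ((η n ω).1 - φ) / w)
      atTop (id : ℝ → ℝ) (fun _ => P) (gaussianReal 0 1) := by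
    refine tendstoInDistribution_of_tendstoInMeasure_sub _ _
      (h.tendstoInDistribution_normalizedSum hm hw) ?_
      (fun n => (((hη_meas n).fst.sub_const φ).const_mul _).div_const w)
    refine (hslope.zero_const_mul w⁻¹).congr_left fun n => .of_forall fun ω => ?_
    simp only [Pi.sub_apply]
    ring
  refine ⟨h1, ?_⟩
  have hone : TendstoInMeasure P (fun n ω => w / √(η n ω).2) atTop (fun _ => 1) := by
    rw [tendstoInMeasure_iff_norm] at hscale ⊢
    simpa using hscale
  -- The studentized statistic is the first one times `w / √x̂`, which tends to `1` in probability.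
  have h2 := h1.continuous_comp_prodMk_of_tendstoInMeasure_const
    (g := fun p : ℝ × ℝ => p.1 * p.2) (by fun_prop) hone
    (fun n => ((hη_meas n).snd.sqrt.const_div w))
  convert h2 using 3 with n
  · exact (div_mul_div_cancel₀ hw.ne').symm
  · simp
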